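/- Let $p\colon M_2\to M_1$ be a Riemannian covering of connected $m$-dimensional Riemannian manifolds with possibly empty, smooth, not necessarily connected boundary. Let $E_1\to M_1$ be a Riemannian (respectively Hermitian) vector bundle of finite rank, put $\mathbb F=\mathbb R$ (respectively $\mathbb F=\mathbb C$), and let $\nabla$ be a connection on $E_1$ (not necessarily metric). Let $D_1\colon\Gamma(E_1)\to\Gamma(E_1)$ be a linear differential operator of arbitrary order $d$, that is, in local coordinates and trivializations $D_1=\sum_{|\alpha|\le d}A^\alpha\,\partial^{|\alpha|}/\partial x^\alpha$ with smooth matrix-valued functions $A^\alpha$. Let $a_1,b_1\colon\partial M_1\to\mathbb F$ be arbitrary functions. Let $E_2=p^*E_1$ be the pullback bundle, endowed with the pulled back metric and the pulled back connection, also denoted by $\nabla$. Let $D_2\colon\Gamma(E_2)\to\Gamma(E_2)$ be the lift of $D_1$, that is, the differential operator given by $$D_2\eta=(p|_U)^*\bigl(D_1\bigl((p|_U^{-1})^*\eta\bigr)\bigr)\quad\text{on } U$$ for every open $U\subset M_2$ that $p$ maps isometrically onto an open subset of $M_1$. Put $a_2=a_1\circ p$ and $b_2=b_1\circ p$, let $n$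 be the inward pointing unit normal to $\partial M_2$, and consider $D_2$ as an unbounded operator in $L^2(E_2)$ with domain $$\mathcal D(D_2)=\{\eta\in\Gamma_c(E_2) : a_2\nabla_n\eta+b_2\eta=0\text{ on }\partial M_2\},$$ where $\Gamma_c(E_2)$ is the space of compactly supported smooth sections (so $\mathcal D(D_2)=\Gamma_c(E_2)$ if the boundary is empty). Assume that $D_2\colon\mathcal D(D_2)\subset L^2(E_2)\to L^2(E_2)$ is symmetric and bounded from below, i.e. there is $c\in\mathbb R$ with $\langle D_2\eta,\eta\rangle\ge c\|\eta\|^2$ for all $\eta\in\mathcal D(D_2)$, and let $D_2^{(F)}$ be its Friedrichs extension, i.e. the restriction of the adjoint $D_2^*$ to $\mathcal D(D_2^*)\cap Q$, where the form domain $Q$ is the set of all limits in $L^2(E_2)$ of sequences $(\eta_k)$ in $\mathcal D(D_2)$ that converge in $L^2(E_2)$ and satisfy $\langle D_2(\eta_k-\eta_l),\eta_k-\eta_l\rangle\to0$ as $k,l\to\infty$. If the group of deck transformations of $p$ is infinite, then $D_2^{(F)}$ has no eigenvalues of finite multiplicity, and $$\sigma(D_2^{(F)})=\sigma_{\mathrm{ess}}(D_2^{(F)}).$$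 Here, for an operator $A\colon\mathcal D(A)\subset\mathcal H\to\mathcal H$ in a Hilbert space $\mathcal H$ over $\mathbb F$, the spectrum $\sigma(A)$ is the set of all $\lambda\in\mathbb F$ for which $A-\lambda\colon\mathcal D(A)\to\mathcal H$ is not bijective, and the essential spectrum $\sigma_{\mathrm{ess}}(A)$ is the set of all $\lambda\in\mathbb F$ for which $A-\lambda$ is not Fredholm, i.e. does not have both a finite-dimensional kernel and a closed range of finite codimension. -/

import Mathlib

open Set Filter Topology MeasureTheory Bundle Manifold
open scoped ContDiff ComplexConjugate

noncomputable section
namespace RiemannianCovering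

set_option linter.unusedSectionVars false

section Frame

variable {V : Type*} [NormedAddCommGroup V] [NormedSpace ℝ V] {H : Type*} [TopologicalSpace H]
  (I : ModelWithCorners ℝ V H) {M : Type*} [TopologicalSpace M] [ChartedSpace H M]

/-- The differential of the inverse of the chart `e`, at the point with coordinates `y`. -/
def chartFrame (e : OpenPartialHomeomorph M H) (y : V) :
    V →L[ℝ] TangentSpace I ((e.extend I).symm y) :=
  mfderivWithin 𝓘(ℝ, V) I (e.extend I).symm (e.extend I).target y

variable {I}

lemma uniqueDiffOn_extend_target (e : OpenPartialHomeomorph M H) :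
    UniqueDiffOn ℝ (e.extend I).target := by
  rw [e.extend_target, inter_comm]
  exact I.uniqueDiffOn.inter (e.open_target.preimage I.continuous_symm)

variable [IsManifold I ∞ M]

lemma contMDiffOn_extend_symm_target {e : OpenPartialHomeomorph M H}
    (he : e ∈ IsManifold.maximalAtlas I ∞ M) :
    ContMDiffOn 𝓘(ℝ, V) I ∞ (e.extend I).symm (e.extend I).target := by
  rw [e.extend_target']
  exact contMDiffOn_extend_symm he

lemma contMDiffOn_chartFrame {e : OpenPartialHomeomorph M H}
    (he : e ∈ IsManifold.maximalAtlas I ∞ M) (v : V) :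
    ContMDiffOn 𝓘(ℝ, V) I.tangent 0
      (fun y ↦ (⟨(e.extend I).symm y, chartFrame I e y v⟩ : TangentBundle I M))
      (e.extend I).target := by
  have h := (contMDiffOn_extend_symm_target he).contMDiffOn_tangentMapWithin (m := 0) (by simp)
    (uniqueDiffOn_extend_target e).uniqueMDiffOn
  have h2 : ContMDiff 𝓘(ℝ, V) 𝓘(ℝ, V).tangent 0
      (fun y : V ↦ (⟨y, v⟩ : TangentBundle 𝓘(ℝ, V) V)) :=
    contMDiff_vectorSpace_iff_contDiff.2 contDiff_const
  exact h.comp h2.contMDiffOn (fun y hy ↦ hy)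

/-- Change of coordinates for the frames of two charts. -/
lemma chartFrame_change {e e' : OpenPartialHomeomorph M H}
    (he : e ∈ IsManifold.maximalAtlas I ∞ M) (he' : e' ∈ IsManifold.maximalAtlas I ∞ M)
    {y : V} (hy : y ∈ (e.extend I).target) (hy' : (e.extend I).symm y ∈ e'.source) :
    ∃ J : V →L[ℝ] V, HasFDerivWithinAt (e'.extend I ∘ (e.extend I).symm) J
      ((e.extend I).target ∩ (e.extend I).symm ⁻¹' e'.source) y ∧
    ∀ v, (chartFrame I e y v : V) =
      chartFrame I e' (e'.extend I ((e.extend I).symm y)) (J v) := by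
  set τ := e'.extend I ∘ (e.extend I).symm with hτ
  have hsymm := contMDiffOn_extend_symm_target (I := I) he
  have hsd := (hsymm y hy).mdifferentiableWithinAt (by simp)
  have hmd : MDifferentiableWithinAt 𝓘(ℝ, V) 𝓘(ℝ, V) τ (e.extend I).target y := by
    refine MDifferentiableAt.comp_mdifferentiableWithinAt (I' := I) y ?_ hsd
    exact (OpenPartialHomeomorph.contMDiffAt_extend he' hy').mdifferentiableAt (by simp)
  have hd : DifferentiableWithinAt ℝ τ (e.extend I).target y := hmd.differentiableWithinAt
  refine ⟨fderivWithin ℝ τ (e.extend I).target y, hd.hasFDerivWithinAt.mono inter_subset_left, ?_⟩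
  have hτy : τ y ∈ (e'.extend I).target := (e'.extend I).map_source (by rwa [e'.extend_source])
  have hsrc : (e.extend I).symm ⁻¹' e'.source ∈ 𝓝[(e.extend I).target] y :=
    hsd.continuousWithinAt (e'.open_source.mem_nhds hy')
  have hev : (e'.extend I).symm ∘ τ =ᶠ[𝓝[(e.extend I).target] y] (e.extend I).symm := by
    filter_upwards [hsrc] with z hz
    exact (e'.extend I).left_inv (by rwa [e'.extend_source])
  have huy : UniqueMDiffWithinAt 𝓘(ℝ, V) (e.extend I).target y :=
    ((uniqueDiffOn_extend_target e) y hy).uniqueMDiffWithinAt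
  have hpre : τ ⁻¹' (e'.extend I).target ∈ 𝓝[(e.extend I).target] y := by
    filter_upwards [hsrc] with z hz
    exact (e'.extend I).map_source (by rwa [e'.extend_source])
  have hcomp := mfderivWithin_comp_of_preimage_mem_nhdsWithin (I'' := I) y
    ((contMDiffOn_extend_symm_target (I := I) he' (τ y) hτy).mdifferentiableWithinAt (by simp))
    hmd hpre huy
  intro v
  have h1 : mfderivWithin 𝓘(ℝ, V) I ((e'.extend I).symm ∘ τ) (e.extend I).target y v =
      (mfderivWithin 𝓘(ℝ, V) I (e'.extend I).symm (e'.extend I).target (τ y))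
        (mfderivWithin 𝓘(ℝ, V) 𝓘(ℝ, V) τ (e.extend I).target y v) := by
    rw [hcomp]; rfl
  rw [mfderivWithin_eq_fderivWithin] at h1
  have h2 := hev.mfderivWithin_eq_of_mem (I := 𝓘(ℝ, V)) (I' := I) hy
  exact (congrArg (fun L ↦ (L v : V)) h2).symm.trans h1

lemma chartFrame_injective {e : OpenPartialHomeomorph M H}
    (he : e ∈ IsManifold.maximalAtlas I ∞ M) {y : V} (hy : y ∈ (e.extend I).target) :
    Function.Injective (chartFrame I e y) := by
  have hs : (e.extend I).symm y ∈ e.source := by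
    rw [← e.extend_source (I := I)]; exact (e.extend I).map_target hy
  have hsd := ((contMDiffOn_extend_symm_target (I := I) he) y hy).mdifferentiableWithinAt (by simp)
  have huy : UniqueMDiffWithinAt 𝓘(ℝ, V) (e.extend I).target y :=
    ((uniqueDiffOn_extend_target e) y hy).uniqueMDiffWithinAt
  have hcomp := mfderiv_comp_mfderivWithin (I'' := 𝓘(ℝ, V)) y
    ((OpenPartialHomeomorph.contMDiffAt_extend he hs).mdifferentiableAt (by simp)) hsd huy
  rw [mfderivWithin_eq_fderivWithin] at hcomp
  have hid : fderivWithin ℝ (e.extend I ∘ (e.extend I).symm) (e.extend I).target y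
      = ContinuousLinearMap.id ℝ V := by
    have h1 : EqOn (e.extend I ∘ (e.extend I).symm) id (e.extend I).target :=
      fun z hz ↦ (e.extend I).right_inv hz
    exact (fderivWithin_congr' h1 hy).trans
      (fderivWithin_id ((uniqueDiffOn_extend_target e) y hy))
  intro v w hvw
  have h1 := congrArg (fun L : V →L[ℝ] V ↦ L v) (hcomp.symm.trans hid)
  have h2 := congrArg (fun L : V →L[ℝ] V ↦ L w) (hcomp.symm.trans hid)
  exact h1.symm.trans ((congrArg (mfderiv I 𝓘(ℝ, V) (e.extend I) ((e.extend I).symm y)) hvw).trans h2)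

end Frame

section Volume

variable {m : ℕ} {H : Type*} [TopologicalSpace H]
  (I : ModelWithCorners ℝ (EuclideanSpace ℝ (Fin m)) H)
  {M : Type*} [TopologicalSpace M] [ChartedSpace H M]
  [RiemannianBundle (fun x : M ↦ TangentSpace I x)]

/-- The function `√ det (gᵢⱼ)`, where `gᵢⱼ = ⟨∂ᵢ, ∂ⱼ⟩`, in the coordinates of the chart `e`. -/
def chartDensity (e : OpenPartialHomeomorph M H) (y : EuclideanSpace ℝ (Fin m)) : ℝ :=
  √ (Matrix.gram ℝ fun i ↦ chartFrame I e y (EuclideanSpace.single i 1)).det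

variable [MeasurableSpace M]

/-- The measure `√ det (gᵢⱼ) dy¹ ⋯ dyᵐ` on the domain of the chart `e` (and zero outside). -/
def chartVolume (e : OpenPartialHomeomorph M H) : Measure M :=
  ((volume.restrict (e.extend I).target).withDensity
    fun y ↦ ENNReal.ofReal (chartDensity I e y)).map (e.extend I).symm

variable (M) in
/-- The Riemannian volume measure: the measure that is given in every chart by
`√ det (gᵢⱼ) dy¹ ⋯ dyᵐ`. As these chart measures agree on overlaps, it is their supremum. -/
def riemannianVolume : Measure M :=
  ⨆ e ∈ IsManifold.maximalAtlas I ∞ M, chartVolume I e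

variable {I} [IsManifold I ∞ M]

lemma gram_change {x x' : M} (h : x' = x) {u : Fin m → TangentSpace I x}
    {w : Fin m → TangentSpace I x'} (A : Matrix (Fin m) (Fin m) ℝ)
    (hu : ∀ i, (u i : EuclideanSpace ℝ (Fin m)) =
      ∑ k, A k i • (w k : EuclideanSpace ℝ (Fin m))) :
    Matrix.gram ℝ u = A.transpose * Matrix.gram ℝ w * A := by
  subst h
  have hu' : ∀ i, u i = ∑ k, A k i • w k := hu
  ext i j
  simp only [Matrix.gram_apply, Matrix.mul_apply, Matrix.transpose_apply, hu', sum_inner,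
    inner_sum, real_inner_smul_left, real_inner_smul_right, Finset.sum_mul]
  refine Finset.sum_congr rfl fun k _ ↦ Finset.sum_congr rfl fun l _ ↦ ?_
  ring

lemma measurableSet_extend_target (e : OpenPartialHomeomorph M H) :
    MeasurableSet (e.extend I).target := by
  rw [e.extend_target]
  exact (e.open_target.preimage I.continuous_symm).measurableSet.inter
    I.isClosed_range.measurableSet

variable [IsContMDiffRiemannianBundle I ∞ (EuclideanSpace ℝ (Fin m))
    (fun x : M ↦ TangentSpace I x)]

lemma continuousOn_chartDensity {e : OpenPartialHomeomorph M H}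
    (he : e ∈ IsManifold.maximalAtlas I ∞ M) :
    ContinuousOn (chartDensity I e) (e.extend I).target := by
  have : IsContMDiffRiemannianBundle I 0 (EuclideanSpace ℝ (Fin m))
      (fun x : M ↦ TangentSpace I x) := IsContMDiffRiemannianBundle.of_le (n := ∞) (by simp)
  have key : ∀ i j, ContinuousOn (fun y ↦ Matrix.gram ℝ
      (fun i ↦ chartFrame I e y (EuclideanSpace.single i 1)) i j)
      (e.extend I).target := fun i j ↦
    ((contMDiffOn_chartFrame he (EuclideanSpace.single i 1)).inner_bundle
      (contMDiffOn_chartFrame he (EuclideanSpace.single j 1))).continuousOn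
  refine Real.continuous_sqrt.comp_continuousOn ?_
  rw [continuousOn_iff_continuous_domRestrict]
  refine Continuous.matrix_det (continuous_matrix fun i j ↦ ?_)
  exact continuousOn_iff_continuous_domRestrict.1 (key i j)

/-- Change of coordinates for the density. -/
lemma chartDensity_eq {e e' : OpenPartialHomeomorph M H}
    {y : EuclideanSpace ℝ (Fin m)}
    (hy' : (e.extend I).symm y ∈ e'.source)
    {J : EuclideanSpace ℝ (Fin m) →L[ℝ] EuclideanSpace ℝ (Fin m)}
    (hJ : ∀ v, (chartFrame I e y v : EuclideanSpace ℝ (Fin m)) =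
      chartFrame I e' (e'.extend I ((e.extend I).symm y)) (J v)) :
    chartDensity I e y =
      |J.det| * chartDensity I e' (e'.extend I ((e.extend I).symm y)) := by
  have hpt : (e'.extend I).symm (e'.extend I ((e.extend I).symm y)) = (e.extend I).symm y :=
    (e'.extend I).left_inv (by rwa [e'.extend_source])
  unfold chartDensity
  generalize e'.extend I ((e.extend I).symm y) = z at *
  have hgram : (Matrix.gram ℝ fun i ↦ chartFrame I e y (EuclideanSpace.single i 1)) =
      (LinearMap.toMatrix (EuclideanSpace.basisFun (Fin m) ℝ).toBasis
        (EuclideanSpace.basisFun (Fin m) ℝ).toBasis J.toLinearMap).transpose *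
      (Matrix.gram ℝ fun i ↦ chartFrame I e' z (EuclideanSpace.single i 1)) *
      (LinearMap.toMatrix (EuclideanSpace.basisFun (Fin m) ℝ).toBasis
        (EuclideanSpace.basisFun (Fin m) ℝ).toBasis J.toLinearMap) := by
    refine gram_change hpt _ fun i ↦ ?_
    rw [hJ]
    have hL : J (EuclideanSpace.single i 1) =
      ∑ k, (LinearMap.toMatrix (EuclideanSpace.basisFun (Fin m) ℝ).toBasis
        (EuclideanSpace.basisFun (Fin m) ℝ).toBasis J.toLinearMap) k i •
          EuclideanSpace.single k (1 : ℝ) := by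
      rw [← (EuclideanSpace.basisFun (Fin m) ℝ).toBasis.sum_repr (J (EuclideanSpace.single i 1))]
      refine Finset.sum_congr rfl fun k _ ↦ ?_
      simp [LinearMap.toMatrix_apply]
    rw [hL, map_sum]
    simp only [map_smul]
    rfl
  rw [hgram, Matrix.det_mul, Matrix.det_mul, Matrix.det_transpose,
    LinearMap.det_toMatrix,
    show J.det = LinearMap.det J.toLinearMap from rfl, ← Real.sqrt_sq_eq_abs,
    ← Real.sqrt_mul (sq_nonneg _)]
  congr 1
  ring


variable [BorelSpace M]

lemma measurableSet_extend_preimage (e : OpenPartialHomeomorph M H) {A : Set M}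
    (hA : MeasurableSet A) : MeasurableSet ((e.extend I).target ∩ (e.extend I).symm ⁻¹' A) := by
  have h : Measurable ((e.extend I).target.domRestrict (e.extend I).symm) :=
    (continuousOn_iff_continuous_domRestrict.1 e.continuousOn_extend_symm).measurable
  have h2 := (measurableSet_extend_target (I := I) e).subtype_image (h hA)
  convert h2 using 1
  exact (Subtype.image_preimage_coe _ _).symm

lemma chartVolume_apply (e : OpenPartialHomeomorph M H) {A : Set M} (hA : MeasurableSet A) :
    chartVolume I e A = ∫⁻ y in (e.extend I).target ∩ (e.extend I).symm ⁻¹' A,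
      ENNReal.ofReal (chartDensity I e y) := by
  have h : AEMeasurable (e.extend I).symm ((volume.restrict (e.extend I).target).withDensity
      fun y ↦ ENNReal.ofReal (chartDensity I e y)) :=
    (e.continuousOn_extend_symm.aemeasurable (measurableSet_extend_target e)).mono_ac
      (withDensity_absolutelyContinuous _ _)
  rw [chartVolume, Measure.map_apply_of_aemeasurable h hA, withDensity_apply',
    Measure.restrict_restrict' (measurableSet_extend_target e), inter_comm]

/-- The measures of two charts agree on the overlap of their domains. -/
lemma chartVolume_apply_le {e e' : OpenPartialHomeomorph M H}
    (he : e ∈ IsManifold.maximalAtlas I ∞ M) (he' : e' ∈ IsManifold.maximalAtlas I ∞ M)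
    {A : Set M} (hA : MeasurableSet A) (hA' : A ⊆ e'.source) :
    chartVolume I e A ≤ chartVolume I e' A := by
  rw [chartVolume_apply e hA, chartVolume_apply e' hA]
  set s := (e.extend I).target ∩ (e.extend I).symm ⁻¹' A with hs
  have hJ : ∀ y ∈ s, ∃ J : EuclideanSpace ℝ (Fin m) →L[ℝ] EuclideanSpace ℝ (Fin m),
      HasFDerivWithinAt (e'.extend I ∘ (e.extend I).symm) J
        ((e.extend I).target ∩ (e.extend I).symm ⁻¹' e'.source) y ∧
      ∀ v, (chartFrame I e y v : EuclideanSpace ℝ (Fin m)) =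
        chartFrame I e' (e'.extend I ((e.extend I).symm y)) (J v) :=
    fun y hy ↦ chartFrame_change he he' hy.1 (hA' hy.2)
  choose! J hJ1 hJ2 using hJ
  have hsm : MeasurableSet s := measurableSet_extend_preimage e hA
  have hinj : InjOn (e'.extend I ∘ (e.extend I).symm) s := by
    refine (e'.extend I).injOn.comp ((e.extend I).symm.injOn.mono inter_subset_left) ?_
    intro y hy
    rw [e'.extend_source]
    exact hA' hy.2
  have himg : (e'.extend I ∘ (e.extend I).symm) '' s ⊆
      (e'.extend I).target ∩ (e'.extend I).symm ⁻¹' A := by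
    rintro _ ⟨y, hy, rfl⟩
    have hy' : (e.extend I).symm y ∈ (e'.extend I).source := by
      rw [e'.extend_source]; exact hA' hy.2
    refine ⟨(e'.extend I).map_source hy', ?_⟩
    simp only [mem_preimage, Function.comp_apply, (e'.extend I).left_inv hy']
    exact hy.2
  calc ∫⁻ y in s, ENNReal.ofReal (chartDensity I e y)
      = ∫⁻ y in s, ENNReal.ofReal |(J y).det| *
          ENNReal.ofReal (chartDensity I e' ((e'.extend I ∘ (e.extend I).symm) y)) := by
        refine setLIntegral_congr_fun hsm fun y hy ↦ ?_
        rw [chartDensity_eq (hA' hy.2) (hJ2 y hy), ENNReal.ofReal_mul (abs_nonneg _)]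
        rfl
    _ = ∫⁻ y in (e'.extend I ∘ (e.extend I).symm) '' s,
          ENNReal.ofReal (chartDensity I e' y) :=
        (lintegral_image_eq_lintegral_abs_det_fderiv_mul volume hsm
          (fun y hy ↦ (hJ1 y hy).mono (inter_subset_inter_right _ (preimage_mono hA'))) hinj
          fun z ↦ ENNReal.ofReal (chartDensity I e' z)).symm
    _ ≤ _ := lintegral_mono_set himg

lemma chartVolume_le_riemannianVolume {e : OpenPartialHomeomorph M H}
    (he : e ∈ IsManifold.maximalAtlas I ∞ M) : chartVolume I e ≤ riemannianVolume I M :=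
  le_iSup₂_of_le e he le_rfl

/-- In a chart, the Riemannian volume is the measure `√ det (gᵢⱼ) dy¹ ⋯ dyᵐ`. -/
lemma riemannianVolume_apply {e : OpenPartialHomeomorph M H}
    (he : e ∈ IsManifold.maximalAtlas I ∞ M) {A : Set M} (hA : MeasurableSet A)
    (hA' : A ⊆ e.source) : riemannianVolume I M A = chartVolume I e A := by
  refine le_antisymm ?_ (chartVolume_le_riemannianVolume he A)
  have hU : MeasurableSet e.source := e.open_source.measurableSet
  have hle : riemannianVolume I M ≤
      chartVolume I e + (riemannianVolume I M).restrict e.sourceᶜ := by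
    refine iSup₂_le fun e' he' ↦ Measure.le_iff.2 fun B hB ↦ ?_
    rw [← measure_inter_add_sdiff B hU, Measure.add_apply, Measure.restrict_apply hB]
    refine add_le_add ?_ (chartVolume_le_riemannianVolume he' _)
    exact (chartVolume_apply_le he' he (hB.inter hU) inter_subset_right).trans
      (measure_mono inter_subset_left)
  refine (hle A).trans (le_of_eq ?_)
  rw [Measure.add_apply, Measure.restrict_apply hA,
    (disjoint_compl_right_iff_subset.2 hA').inter_eq, measure_empty, add_zero]

instance : IsLocallyFiniteMeasure (riemannianVolume I M) := by
  refine ⟨fun x ↦ ?_⟩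
  set e := chartAt H x with he
  have hem : e ∈ IsManifold.maximalAtlas I ∞ M := IsManifold.chart_mem_maximalAtlas x
  have hx : x ∈ e.source := mem_chart_source H x
  set y := e.extend I x with hy
  have hyt : y ∈ (e.extend I).target := (e.extend I).map_source (by rwa [e.extend_source])
  -- near `y`, the density is bounded
  have hb : ∀ᶠ z in 𝓝[(e.extend I).target] y, chartDensity I e z < chartDensity I e y + 1 :=
    (continuousOn_chartDensity hem y hyt).eventually (gt_mem_nhds (by linarith))
  obtain ⟨r, hr, hball⟩ := Metric.mem_nhdsWithin_iff.1 hb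
  refine ⟨e.source ∩ e.extend I ⁻¹' Metric.ball y r,
    (e.isOpen_extend_preimage Metric.isOpen_ball).mem_nhds ⟨hx, Metric.mem_ball_self hr⟩, ?_⟩
  have hm : MeasurableSet (e.source ∩ e.extend I ⁻¹' Metric.ball y r) :=
    (e.isOpen_extend_preimage Metric.isOpen_ball).measurableSet
  rw [riemannianVolume_apply hem hm inter_subset_left, chartVolume_apply e hm]
  have hsub : (e.extend I).target ∩ (e.extend I).symm ⁻¹' (e.source ∩ e.extend I ⁻¹' Metric.ball y r)
      ⊆ Metric.ball y r := by
    rintro z ⟨hz, -, hz2⟩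
    rwa [mem_preimage, (e.extend I).right_inv hz] at hz2
  calc _ ≤ ∫⁻ z in (e.extend I).target ∩
        (e.extend I).symm ⁻¹' (e.source ∩ e.extend I ⁻¹' Metric.ball y r),
        ENNReal.ofReal (chartDensity I e y + 1) := by
        refine setLIntegral_mono' (measurableSet_extend_preimage e hm) fun z hz ↦ ?_
        exact ENNReal.ofReal_le_ofReal (hball ⟨hsub hz, hz.1⟩ : _ < _).le
    _ ≤ ENNReal.ofReal (chartDensity I e y + 1) * volume (Metric.ball y r) := by
        rw [setLIntegral_const]
        gcongr
    _ < ⊤ := ENNReal.mul_lt_top ENNReal.ofReal_lt_top measure_ball_lt_top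

lemma chartDensity_pos {e : OpenPartialHomeomorph M H}
    (he : e ∈ IsManifold.maximalAtlas I ∞ M) {y : EuclideanSpace ℝ (Fin m)}
    (hy : y ∈ (e.extend I).target) : 0 < chartDensity I e y := by
  have hli : LinearIndependent ℝ
      (fun i ↦ chartFrame I e y (EuclideanSpace.single i 1)) := by
    have h0 : LinearIndependent ℝ (fun i : Fin m ↦ EuclideanSpace.single i (1 : ℝ)) := by
      have h1 := (EuclideanSpace.basisFun (Fin m) ℝ).toBasis.linearIndependent
      have h2 : ⇑(EuclideanSpace.basisFun (Fin m) ℝ).toBasis =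
          fun i ↦ EuclideanSpace.single i (1 : ℝ) := by
        ext1 i
        simp
      rwa [h2] at h1
    exact h0.map' (chartFrame I e y).toLinearMap
      (LinearMap.ker_eq_bot.2 (chartFrame_injective he hy))
  exact Real.sqrt_pos.2 (Matrix.posDef_gram_of_linearIndependent hli).det_pos

instance : (riemannianVolume I M).IsOpenPosMeasure := by
  refine ⟨fun U hU ⟨x, hx⟩ ↦ ?_⟩
  set e := chartAt H x with he
  have hem : e ∈ IsManifold.maximalAtlas I ∞ M := IsManifold.chart_mem_maximalAtlas x
  have hV : IsOpen (e.source ∩ U) := e.open_source.inter hU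
  suffices h : riemannianVolume I M (e.source ∩ U) ≠ 0 from
    fun h0 ↦ h (measure_mono_null inter_subset_right h0)
  rw [riemannianVolume_apply hem hV.measurableSet inter_subset_left,
    chartVolume_apply e hV.measurableSet]
  set W := I.symm ⁻¹' (e.target ∩ e.symm ⁻¹' U) with hW
  have hWo : IsOpen W := (e.isOpen_inter_preimage_symm hU).preimage I.continuous_symm
  set O := W ∩ interior (range I) with hO
  have hOo : IsOpen O := hWo.inter isOpen_interior
  have hOne : O.Nonempty := by
    have hx' : x ∈ e.source := mem_chart_source H x
    have h1 : I (e x) ∈ W := by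
      simp [hW, hx', hx, e.map_source hx']
    exact mem_closure_iff.1 (I.range_subset_closure_interior (mem_range_self (e x))) W hWo h1
  have hOs : O ⊆ (e.extend I).target := fun z hz ↦ by
    rw [e.extend_target]
    exact ⟨hz.1.1, interior_subset hz.2⟩
  have hOs' : O ⊆ (e.extend I).target ∩ (e.extend I).symm ⁻¹' (e.source ∩ U) := fun z hz ↦
    ⟨hOs hz, by
      rw [← e.extend_source (I := I)]; exact (e.extend I).map_target (hOs hz), hz.1.2⟩
  intro h0
  have h1 : ∫⁻ z in O, ENNReal.ofReal (chartDensity I e z) = 0 :=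
    le_antisymm ((lintegral_mono_set hOs').trans h0.le) bot_le
  have hae : AEMeasurable (fun z ↦ ENNReal.ofReal (chartDensity I e z)) (volume.restrict O) :=
    (((continuousOn_chartDensity hem).mono hOs).aemeasurable hOo.measurableSet).ennreal_ofReal
  rw [lintegral_eq_zero_iff' hae, EventuallyEq, ae_restrict_iff' hOo.measurableSet] at h1
  refine (hOo.measure_pos volume hOne).ne' (measure_mono_null (fun z hz ↦ ?_) h1)
  intro h2
  have h3 := h2 hz
  simp only [Pi.zero_apply, ENNReal.ofReal_eq_zero] at h3
  exact absurd (chartDensity_pos hem (hOs hz)) (not_lt.2 h3)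

end Volume
/-- The fibres of a pullback bundle are additive groups. -/
instance pullbackAddCommGroup {B B' : Type*} (f : B' → B) (E : B → Type*)
    [∀ x, AddCommGroup (E x)] (y : B') : AddCommGroup ((f *ᵖ E) y) :=
  inferInstanceAs (AddCommGroup (E (f y)))

/-! ### Smooth sections, metrics, connections and differential operators on vector bundles -/

section Bundles

variable {m : ℕ} {H : Type*} [TopologicalSpace H]
  (I : ModelWithCorners ℝ (EuclideanSpace ℝ (Fin m)) H)
  {M : Type*} [TopologicalSpace M] [ChartedSpace H M]
  (𝕜 : Type*) [RCLike 𝕜]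
  (F : Type*) [NormedAddCommGroup F] [NormedSpace ℝ F] [NormedSpace 𝕜 F] [IsScalarTower ℝ 𝕜 F]
  (E : M → Type*) [∀ x, AddCommGroup (E x)] [∀ x, Module ℝ (E x)] [∀ x, Module 𝕜 (E x)]
  [∀ x, TopologicalSpace (E x)] [TopologicalSpace (TotalSpace F E)] [FiberBundle F E]
  [VectorBundle ℝ F E] [VectorBundle 𝕜 F E] [ContMDiffVectorBundle ∞ F E I]

lemma contMDiffAt_const_smul_section (c : 𝕜) {s : Π x, E x} {x₀ : M}
    (hs : ContMDiffAt I (I.prod 𝓘(ℝ, F)) ∞ (fun x ↦ TotalSpace.mk' F x (s x)) x₀) :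
    ContMDiffAt I (I.prod 𝓘(ℝ, F)) ∞ (fun x ↦ TotalSpace.mk' F x ((c • s) x)) x₀ := by
  rw [contMDiffAt_section] at hs ⊢
  have h1 : ContMDiffAt I 𝓘(ℝ, F) ∞
      (fun x ↦ c • (trivializationAt F E x₀ ⟨x, s x⟩).2) x₀ :=
    ((c • ContinuousLinearMap.id 𝕜 F).restrictScalars ℝ).contMDiff.contMDiffAt.comp x₀ hs
  refine h1.congr_of_eventuallyEq ?_
  filter_upwards [(trivializationAt F E x₀).open_baseSet.mem_nhds
    (mem_baseSet_trivializationAt F E x₀)] with x hx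
  exact ((trivializationAt F E x₀).linear 𝕜 hx).map_smul c (s x)

/-- The space `Γ(E)` of smooth sections of the vector bundle `E`. -/
def smoothSections : Submodule 𝕜 (Π x, E x) where
  carrier := {s | ContMDiff I (I.prod 𝓘(ℝ, F)) ∞ fun x ↦ TotalSpace.mk' F x (s x)}
  add_mem' hs ht := ContMDiff.add_section hs ht
  zero_mem' := contMDiff_zeroSection ℝ E
  smul_mem' c _ hs x := contMDiffAt_const_smul_section I 𝕜 F E c (hs x)

/-- The space `Γ_c(E)` of compactly supported smooth sections of the vector bundle `E`. -/
def compactlySupportedSections : Submodule 𝕜 (smoothSections I 𝕜 F E) where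
  carrier := {s | IsCompact (closure {x | s.1 x ≠ 0})}
  add_mem' hs ht := by
    refine (IsCompact.union hs ht).of_isClosed_subset isClosed_closure ?_
    rw [← closure_union]
    refine closure_mono fun x hx ↦ ?_
    by_contra h
    simp only [mem_union, mem_ofPred_eq, not_or, not_not] at h
    exact hx (by simp [h.1, h.2])
  zero_mem' := by simp
  smul_mem' c _ hs := by
    refine IsCompact.of_isClosed_subset hs isClosed_closure (closure_mono fun x hx h ↦ hx ?_)
    simp [h]

/-- A Riemannian (for `𝕜 = ℝ`) or Hermitian (for `𝕜 = ℂ`) metric on the vector bundle `E`: a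
positive definite inner product on every fibre, with smooth coefficients in the trivializations. -/
structure HermitianMetric where
  /-- The inner product on the fibre at `x`, conjugate-linear in the first variable. -/
  inner (x : M) : E x →ₗ⋆[𝕜] E x →ₗ[𝕜] 𝕜
  conj_inner_symm (x : M) (v w : E x) : conj (inner x w v) = inner x v w
  inner_self_pos (x : M) (v : E x) : v ≠ 0 → 0 < RCLike.re (inner x v v)
  contMDiffOn (x₀ : M) (u v : F) : ContMDiffOn I 𝓘(ℝ, 𝕜) ∞
    (fun x ↦ inner x ((trivializationAt F E x₀).symm x u) ((trivializationAt F E x₀).symm x v))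
    (trivializationAt F E x₀).baseSet

/-- A (smooth, `𝕜`-linear) connection on the vector bundle `E`. -/
structure Connection [IsManifold I ∞ M] [∀ x, IsTopologicalAddGroup (E x)]
    [∀ x, ContinuousSMul ℝ (E x)] extends CovariantDerivative I F E where
  map_smul (c : 𝕜) (σ : Π x, E x) (x : M)
    (hσ : MDifferentiableAt I (I.prod 𝓘(ℝ, F)) (fun x ↦ TotalSpace.mk' F x (σ x)) x)
    (v : TangentSpace I x) : toFun (c • σ) x v = c • toFun σ x v
  contMDiff : CovariantDerivative.ContMDiffCovariantDerivative toCovariantDerivative ∞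

variable {𝕜 E}

/-- The coordinates `y` for which both the chart and the trivialization at `x₀` are defined. -/
def localDomain (x₀ : M) : Set (EuclideanSpace ℝ (Fin m)) :=
  (extChartAt I x₀).target ∩ (extChartAt I x₀).symm ⁻¹' (trivializationAt F E x₀).baseSet

/-- The expression of a section in the chart and the trivialization at `x₀`. -/
def localExpr (x₀ : M) (s : Π x, E x) (y : EuclideanSpace ℝ (Fin m)) : F :=
  (trivializationAt F E x₀ ⟨(extChartAt I x₀).symm y, s ((extChartAt I x₀).symm y)⟩).2

variable (𝕜 E)

/-- A linear differential operator `D : Γ(E) → Γ(E)` (of some order `d`): in local coordinates and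
trivializations, it is `∑_{k ≤ d} ∑_{w} A_{k,w} ∂_{w₁} ⋯ ∂_{wₖ}`, where `w` runs through the
`k`-tuples of coordinate directions and the `A_{k,w}` are smooth and matrix-valued. -/
structure DifferentialOperator where
  /-- The action of the operator on smooth sections. -/
  toLinearMap : smoothSections I 𝕜 F E →ₗ[𝕜] smoothSections I 𝕜 F E
  exists_localExpr : ∃ d : ℕ, ∀ x₀ : M,
    ∃ A : (k : ℕ) → (Fin k → Fin m) → EuclideanSpace ℝ (Fin m) → F →L[𝕜] F,
      (∀ k w, ContDiffOn ℝ ∞ (A k w) (localDomain I F (E := E) x₀)) ∧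
      ∀ s : smoothSections I 𝕜 F E, ∀ y ∈ localDomain I F (E := E) x₀,
        localExpr I F x₀ (toLinearMap s).1 y =
          ∑ k ∈ Finset.range (d + 1), ∑ w : Fin k → Fin m,
            A k w y (iteratedFDerivWithin ℝ k (localExpr I F x₀ s.1)
              (localDomain I F (E := E) x₀) y fun j ↦ EuclideanSpace.single (w j) 1)

variable {I 𝕜 F E}

/-- Differential operators are local. -/
lemma DifferentialOperator.congr (D : DifferentialOperator I 𝕜 F E)
    {s t : smoothSections I 𝕜 F E} {x : M} (h : ∀ᶠ z in 𝓝 x, s.1 z = t.1 z) :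
    (D.toLinearMap s).1 x = (D.toLinearMap t).1 x := by
  obtain ⟨d, hd⟩ := D.exists_localExpr
  obtain ⟨A, -, hA⟩ := hd x
  have hx : extChartAt I x x ∈ localDomain I F (E := E) x := by
    refine ⟨mem_extChartAt_target x, ?_⟩
    simpa using mem_baseSet_trivializationAt F E x
  have hst : localExpr I F x s.1 =ᶠ[𝓝 (extChartAt I x x)] localExpr I F x t.1 := by
    have h1 : Tendsto (extChartAt I x).symm (𝓝 (extChartAt I x x)) (𝓝 x) := by
      have := continuousAt_extChartAt_symm (I := I) x
      rwa [ContinuousAt, extChartAt_to_inv] at this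
    filter_upwards [h1.eventually h] with y hy
    simp only [localExpr, hy]
  have h2 : localExpr I F x (D.toLinearMap s).1 (extChartAt I x x) =
      localExpr I F x (D.toLinearMap t).1 (extChartAt I x x) := by
    rw [hA s _ hx, hA t _ hx]
    refine Finset.sum_congr rfl fun k _ ↦ Finset.sum_congr rfl fun w _ ↦ ?_
    rw [(hst.filter_mono nhdsWithin_le_nhds).iteratedFDerivWithin_eq hst.self_of_nhds]
  simp only [localExpr] at h2
  rw [extChartAt_to_inv] at h2
  exact ((trivializationAt F E x).linearEquivAt ℝ x
    (mem_baseSet_trivializationAt F E x)).injective h2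

lemma HermitianMetric.continuous_inner [FiniteDimensional 𝕜 F] (h : HermitianMetric I 𝕜 F E)
    (s t : smoothSections I 𝕜 F E) : Continuous fun x ↦ h.inner x (s.1 x) (t.1 x) := by
  rw [continuous_iff_continuousAt]
  intro x₀
  set e := trivializationAt F E x₀ with he
  have hx₀ : x₀ ∈ e.baseSet := mem_baseSet_trivializationAt F E x₀
  set b := Module.finBasis 𝕜 F
  have hc : ∀ (r : smoothSections I 𝕜 F E) i,
      ContinuousAt (fun x ↦ b.repr (e ⟨x, r.1 x⟩).2 i) x₀ := fun r i ↦ by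
    have h1 : ContinuousAt (fun x ↦ (e ⟨x, r.1 x⟩).2) x₀ :=
      ((contMDiffAt_section (F := F) (E := E) x₀).1 (r.2 x₀)).continuousAt
    exact (b.coord i).continuous_of_finiteDimensional.continuousAt.comp h1
  have hcont : ContinuousAt (fun x ↦ ∑ i, ∑ j, conj (b.repr (e ⟨x, s.1 x⟩).2 i) *
      (b.repr (e ⟨x, t.1 x⟩).2 j * h.inner x (e.symm x (b i)) (e.symm x (b j)))) x₀ := by
    refine tendsto_finsetSum _ fun i _ ↦ tendsto_finsetSum _ fun j _ ↦ ?_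
    refine ((RCLike.continuous_conj.continuousAt.comp (hc s i))).mul ((hc t j).mul ?_)
    exact (h.contMDiffOn x₀ (b i) (b j)).continuousOn.continuousAt (e.open_baseSet.mem_nhds hx₀)
  refine hcont.congr ?_
  filter_upwards [e.open_baseSet.mem_nhds hx₀] with x hx
  have hr : ∀ r : smoothSections I 𝕜 F E,
      r.1 x = ∑ i, b.repr (e ⟨x, r.1 x⟩).2 i • e.symm x (b i) := fun r ↦ by
    have h1 : r.1 x = e.symmₗ 𝕜 x (e ⟨x, r.1 x⟩).2 := by
      rw [Trivialization.coe_symmₗ _ hx, Trivialization.symm_apply_apply_mk _ hx]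
    conv_lhs => rw [h1, ← b.sum_repr (e ⟨x, r.1 x⟩).2, map_sum]
    simp [Trivialization.coe_symmₗ _ hx]
  conv_rhs => rw [hr s, hr t]
  simp only [map_sum, LinearMap.sum_apply, map_smul, LinearMap.map_smulₛₗ, LinearMap.smul_apply,
    smul_eq_mul]
  rw [Finset.sum_comm]
  refine Finset.sum_congr rfl fun i _ ↦ ?_
  rw [Finset.mul_sum]
  refine Finset.sum_congr rfl fun j _ ↦ ?_
  ring

/-- The pullback of a metric. -/
def HermitianMetric.pullback {M' : Type*} [TopologicalSpace M'] [ChartedSpace H M']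
    (h : HermitianMetric I 𝕜 F E) (p : C^∞⟮I, M'; I, M⟯) :
    HermitianMetric I 𝕜 F (p *ᵖ E) where
  inner y := h.inner (p y)
  conj_inner_symm y := h.conj_inner_symm (p y)
  inner_self_pos y := h.inner_self_pos (p y)
  contMDiffOn y₀ u v := by
    have h1 := (h.contMDiffOn (p y₀) u v).comp (p.contMDiff.contMDiffOn
      (s := (trivializationAt F (p *ᵖ E) y₀).baseSet)) (fun y hy ↦ hy)
    refine h1.congr fun y hy ↦ ?_
    have hsymm : ∀ u : F, (trivializationAt F (p *ᵖ E) y₀).symm y u =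
        (trivializationAt F E (p y₀)).symm (p y) u := fun u ↦ by
      rw [Trivialization.symm_apply _ hy]
      rfl
    rw [hsymm, hsymm]
    rfl

end Bundles

/-! ### Lifting differential operators and connections along a covering -/

section Lift

variable {m : ℕ} {H : Type*} [TopologicalSpace H]
  {I : ModelWithCorners ℝ (EuclideanSpace ℝ (Fin m)) H}
  {M₁ M₂ : Type*} [TopologicalSpace M₁] [ChartedSpace H M₁] [TopologicalSpace M₂]
  [ChartedSpace H M₂]

variable (I) in
/-- A Riemannian covering: a smooth covering map that is a local isometry. -/
structure IsRiemannianCovering [RiemannianBundle (fun x : M₁ ↦ TangentSpace I x)]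
    [RiemannianBundle (fun y : M₂ ↦ TangentSpace I y)] (p : M₂ → M₁) : Prop where
  isCoveringMap : IsCoveringMap p
  isLocalDiffeomorph : IsLocalDiffeomorph I I ∞ p
  norm_mfderiv (y : M₂) (v : TangentSpace I y) : ‖mfderiv I I p y v‖ = ‖v‖

/-- The group of deck transformations of a map `p`: the homeomorphisms `g` with `p ∘ g = p`. -/
def deckTransformationGroup (p : M₂ → M₁) : Subgroup (M₂ ≃ₜ M₂) where
  carrier := {g | ∀ y, p (g y) = p y}
  mul_mem' {g k} hg hk y := (hg (k y)).trans (hk y)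
  one_mem' _ := rfl
  inv_mem' {g} hg y := by
    have h := hg (g⁻¹ y)
    rw [← h]
    exact congrArg p (g.apply_symm_apply y)

variable {𝕜 : Type*} [RCLike 𝕜]
  {F : Type*} [NormedAddCommGroup F] [NormedSpace ℝ F] [NormedSpace 𝕜 F] [IsScalarTower ℝ 𝕜 F]
  {E : M₁ → Type*} [∀ x, AddCommGroup (E x)] [∀ x, Module ℝ (E x)] [∀ x, Module 𝕜 (E x)]
  [∀ x, TopologicalSpace (E x)] [TopologicalSpace (TotalSpace F E)] [FiberBundle F E]
  [VectorBundle ℝ F E] [VectorBundle 𝕜 F E] [ContMDiffVectorBundle ∞ F E I]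
  [IsManifold I ∞ M₁] [T2Space M₁]
  {p : C^∞⟮I, M₂; I, M₁⟯}

/-- Near any point, a section of the pullback bundle is the pullback of a section. -/
lemma exists_descent (hp : IsLocalDiffeomorph I I ∞ p)
    (η : smoothSections I 𝕜 F (p *ᵖ E)) (y : M₂) :
    ∃ σ : smoothSections I 𝕜 F E, ∀ᶠ z in 𝓝 y, σ.1 (p z) = η.1 z := by
  obtain ⟨Φ, hy, hΦ⟩ := hp y
  set e := trivializationAt F E (p y) with he
  have hpy : p y ∈ Φ.target := by
    rw [hΦ hy]; exact Φ.map_source hy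
  obtain ⟨f, -, hf⟩ := (SmoothBumpFunction.nhds_basis_tsupport (I := I) (p y)).mem_iff.1
    ((Φ.open_target.inter e.open_baseSet).mem_nhds ⟨hpy, mem_baseSet_trivializationAt F E (p y)⟩)
  have hpΦ : ∀ x ∈ Φ.target, p (Φ.symm x) = x := fun x hx ↦ by
    exact (hΦ (Φ.map_target hx)).trans (Φ.right_inv hx)
  -- the section `η` in the trivialization `e`, carried to `M₁`
  set g : M₁ → F := fun x ↦ (e ⟨p (Φ.symm x), η.1 (Φ.symm x)⟩).2 with hg
  have hgs : ∀ x ∈ Φ.target ∩ e.baseSet, ContMDiffAt I 𝓘(ℝ, F) ∞ g x := by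
    rintro x ⟨hx, hxe⟩
    have h1 : ContMDiffAt I 𝓘(ℝ, F) ∞ (fun z ↦ (e ⟨p z, η.1 z⟩).2) (Φ.symm x) := by
      have : MemTrivializationAtlas (e.pullback p) := ⟨⟨e, inferInstance, rfl⟩⟩
      exact ((e.pullback p).contMDiffAt_section_iff (s := η.1) (IB := I) (n := ∞) (x₀ := Φ.symm x)
        (by change p (Φ.symm x) ∈ e.baseSet; exact (hpΦ x hx).symm ▸ hxe)).1 (η.2 (Φ.symm x))
    exact h1.comp x ((Φ.contMDiffOn_invFun x hx).contMDiffAt (Φ.open_target.mem_nhds hx))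
  refine ⟨⟨fun x ↦ f x • e.symm x (g x), fun x ↦ ?_⟩, ?_⟩
  · by_cases hx : x ∈ tsupport f
    · have hxm := hf hx
      rw [e.contMDiffAt_section_iff hxm.2]
      refine ((f.contMDiffAt (x := x)).smul (hgs x hxm)).congr_of_eventuallyEq ?_
      filter_upwards [e.open_baseSet.mem_nhds hxm.2] with x' hx'
      rw [(e.linear ℝ hx').map_smul, e.apply_mk_symm hx']
      rfl
    · refine ((contMDiff_zeroSection ℝ E) x).congr_of_eventuallyEq ?_
      filter_upwards [(isClosed_tsupport f).isOpen_compl.mem_nhds hx] with x' hx'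
      have : f x' = 0 := image_eq_zero_of_notMem_tsupport hx'
      simp [this, zeroSection]
  · have h1 : ∀ᶠ z in 𝓝 y, f (p z) = 1 :=
      p.contMDiff.continuous.continuousAt.eventually f.eventuallyEq_one
    have h2 : ∀ᶠ z in 𝓝 y, p z ∈ e.baseSet :=
      p.contMDiff.continuous.continuousAt.eventually
        (e.open_baseSet.mem_nhds (mem_baseSet_trivializationAt F E (p y)))
    filter_upwards [h1, h2, Φ.open_source.mem_nhds hy] with z hz1 hz2 hz3
    have h3 : Φ.symm (p z) = z := by rw [hΦ hz3]; exact Φ.left_inv hz3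
    change f (p z) • e.symm (p z) (g (p z)) = η.1 z
    rw [hz1, one_smul]
    simp only [hg]
    rw [h3]
    exact e.symm_apply_apply_mk hz2 _

/-- A section of `E` whose pullback agrees with `η` near `y`, i.e. an extension of the local section
`(p|_U⁻¹)^* η`, where `U` is a small neighbourhood of `y`. -/
def descend (hp : IsLocalDiffeomorph I I ∞ p) (η : smoothSections I 𝕜 F (p *ᵖ E)) (y : M₂) :
    smoothSections I 𝕜 F E :=
  (exists_descent hp η y).choose

lemma descend_spec (hp : IsLocalDiffeomorph I I ∞ p) (η : smoothSections I 𝕜 F (p *ᵖ E)) (y : M₂) :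
    ∀ᶠ z in 𝓝 y, (descend hp η y).1 (p z) = η.1 z :=
  (exists_descent hp η y).choose_spec

lemma eventually_eq_of_pullback (hp : IsLocalDiffeomorph I I ∞ p) {σ τ : Π x, E x} {y : M₂}
    (h : ∀ᶠ z in 𝓝 y, σ (p z) = τ (p z)) : ∀ᶠ x in 𝓝 (p y), σ x = τ x := by
  rw [← hp.isLocalHomeomorph.map_nhds_eq y]
  exact h

/-- The lift `D₂` of the differential operator `D₁`: near any point `y`, it is given by
`D₂ η = p^* (D₁ ((p|_U⁻¹)^* η))`, where `U` is a small neighbourhood of `y`. -/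
def DifferentialOperator.lift (D : DifferentialOperator I 𝕜 F E)
    (hp : IsLocalDiffeomorph I I ∞ p) :
    smoothSections I 𝕜 F (p *ᵖ E) →ₗ[𝕜] smoothSections I 𝕜 F (p *ᵖ E) :=
  have key : ∀ (η : smoothSections I 𝕜 F (p *ᵖ E)) (y : M₂) (σ : smoothSections I 𝕜 F E),
      (∀ᶠ z in 𝓝 y, σ.1 (p z) = η.1 z) →
      (D.toLinearMap (descend hp η y)).1 (p y) = (D.toLinearMap σ).1 (p y) := fun η y σ hσ ↦ by
    refine D.congr (eventually_eq_of_pullback hp ?_)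
    filter_upwards [hσ, descend_spec hp η y] with z h1 h2 using h2.trans h1.symm
  { toFun η := ⟨fun y ↦ (D.toLinearMap (descend hp η y)).1 (p y), fun y ↦ by
      set e := trivializationAt F E (p y) with he
      set τ := D.toLinearMap (descend hp η y) with hτ
      have hloc : ∀ᶠ z in 𝓝 y, (D.toLinearMap (descend hp η z)).1 (p z) = τ.1 (p z) := by
        filter_upwards [(descend_spec hp η y).eventually_nhds] with z hz
        exact key η z (descend hp η y) hz
      refine (contMDiffAt_section (F := F) (E := p *ᵖ E)
        (s := fun y ↦ (D.toLinearMap (descend hp η y)).1 (p y)) y).2 ?_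
      have h1 : ContMDiffAt I 𝓘(ℝ, F) ∞ (fun x ↦ (e ⟨x, τ.1 x⟩).2) (p y) :=
        (contMDiffAt_section (F := F) (E := E) (p y)).1 (τ.2 (p y))
      refine (h1.comp y p.contMDiff.contMDiffAt).congr_of_eventuallyEq ?_
      filter_upwards [hloc] with z hz
      exact congrArg (fun v ↦ (e ⟨p z, v⟩).2) hz⟩
    map_add' η θ := by
      ext y
      refine (key (η + θ) y (descend hp η y + descend hp θ y) ?_).trans ?_
      · filter_upwards [descend_spec hp η y, descend_spec hp θ y] with z h1 h2
        exact congrArg₂ (· + ·) h1 h2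
      · rw [map_add]; rfl
    map_smul' c η := by
      ext y
      refine (key (c • η) y (c • descend hp η y) ?_).trans ?_
      · filter_upwards [descend_spec hp η y] with z h1
        exact congrArg (c • ·) h1
      · rw [map_smul]; rfl }

end Lift

/-! ### The boundary condition -/

section Boundary

variable {m : ℕ} {H : Type*} [TopologicalSpace H]
  (I : ModelWithCorners ℝ (EuclideanSpace ℝ (Fin m)) H)
  {M : Type*} [TopologicalSpace M] [ChartedSpace H M]

/-- The tangent vector `v` at `x` does not point out of the manifold. (Tangent vectors at `x` are
identified with vectors of the model space through the preferred chart at `x`.) -/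
def WeaklyInward (x : M) (v : TangentSpace I x) : Prop :=
  let w : EuclideanSpace ℝ (Fin m) := v
  ∀ᶠ t : ℝ in 𝓝[>] 0, extChartAt I x x + t • w ∈ range I

/-- `n` is the inward pointing unit normal at the boundary point `x`: it has unit length, points
inward, and is orthogonal to the tangent space of the boundary. -/
structure IsInwardNormal [RiemannianBundle (fun x : M ↦ TangentSpace I x)] (x : M)
    (n : TangentSpace I x) : Prop where
  norm_eq_one : ‖n‖ = 1
  weaklyInward : WeaklyInward I x n
  inner_eq_zero (v : TangentSpace I x) :
    WeaklyInward I x v → WeaklyInward I x (-v) → inner ℝ n v = 0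

end Boundary

section Domain

variable {m : ℕ} {H : Type*} [TopologicalSpace H]
  {I : ModelWithCorners ℝ (EuclideanSpace ℝ (Fin m)) H}
  {M₁ M₂ : Type*} [TopologicalSpace M₁] [ChartedSpace H M₁] [TopologicalSpace M₂]
  [ChartedSpace H M₂]
  {𝕜 : Type*} [RCLike 𝕜]
  {F : Type*} [NormedAddCommGroup F] [NormedSpace ℝ F] [NormedSpace 𝕜 F] [IsScalarTower ℝ 𝕜 F]
  {E : M₁ → Type*} [∀ x, AddCommGroup (E x)] [∀ x, Module ℝ (E x)] [∀ x, Module 𝕜 (E x)]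
  [∀ x, TopologicalSpace (E x)] [∀ x, IsTopologicalAddGroup (E x)] [∀ x, ContinuousSMul ℝ (E x)]
  [TopologicalSpace (TotalSpace F E)] [FiberBundle F E]
  [VectorBundle ℝ F E] [VectorBundle 𝕜 F E] [ContMDiffVectorBundle ∞ F E I]
  [IsManifold I ∞ M₁] [T2Space M₁]
  {p : C^∞⟮I, M₂; I, M₁⟯}

/-- The pullback of the connection `∇`: `(p^*∇)_v η = ∇_{dp(v)} ((p|_U⁻¹)^* η)` for `v` a tangent
vector at `y`, where `U` is a small neighbourhood of `y`. -/
def Connection.lift (nab : Connection I 𝕜 F E) (hp : IsLocalDiffeomorph I I ∞ p) (y : M₂)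
    (v : TangentSpace I y) : smoothSections I 𝕜 F (p *ᵖ E) →ₗ[𝕜] (p *ᵖ E) y :=
  have smooth : ∀ (σ : smoothSections I 𝕜 F E) (x : M₁),
      MDifferentiableAt I (I.prod 𝓘(ℝ, F)) (fun x ↦ TotalSpace.mk' F x (σ.1 x)) x := fun σ x ↦
    (σ.2 x).mdifferentiableAt (by simp)
  have key : ∀ (η : smoothSections I 𝕜 F (p *ᵖ E)) (σ : smoothSections I 𝕜 F E),
      (∀ᶠ z in 𝓝 y, σ.1 (p z) = η.1 z) →
      nab.toFun (descend hp η y).1 (p y) = nab.toFun σ.1 (p y) := fun η σ hσ ↦ by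
    refine nab.isCovariantDerivativeOnUniv.congr_of_eventuallyEq (smooth _ _) (smooth _ _)
      univ_mem (eventually_eq_of_pullback hp ?_)
    filter_upwards [hσ, descend_spec hp η y] with z h1 h2 using h2.trans h1.symm
  { toFun η := nab.toFun (descend hp η y).1 (p y) (mfderiv I I p y v)
    map_add' η θ := by
      have h1 := key (η + θ) (descend hp η y + descend hp θ y) (by
        filter_upwards [descend_spec hp η y, descend_spec hp θ y] with z h1 h2
        exact congrArg₂ (· + ·) h1 h2)
      have h2 := nab.isCovariantDerivativeOnUniv.add (smooth (descend hp η y) (p y))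
        (smooth (descend hp θ y) (p y))
      exact congrArg (fun L ↦ L (mfderiv I I p y v)) (h1.trans h2)
    map_smul' c η := by
      have h1 := key (c • η) (c • descend hp η y) (by
        filter_upwards [descend_spec hp η y] with z h1
        exact congrArg (c • ·) h1)
      refine (congrArg (fun L ↦ L (mfderiv I I p y v)) h1).trans ?_
      exact nab.map_smul c _ (p y) (smooth (descend hp η y) (p y)) _ }

/-- The sections `η` of `E₂ = p^*E` with `a₂ ∇_n η + b₂ η = 0` on `∂M₂`, where `n` is the inward
pointing unit normal, `a₂ = a ∘ p` and `b₂ = b ∘ p`. Only the values of `a` and `b` on the boundary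
matter. -/
def boundaryCondition [RiemannianBundle (fun y : M₂ ↦ TangentSpace I y)]
    (nab : Connection I 𝕜 F E) (hp : IsLocalDiffeomorph I I ∞ p) (a b : M₁ → 𝕜) :
    Submodule 𝕜 (smoothSections I 𝕜 F (p *ᵖ E)) where
  carrier := {η | ∀ y ∈ I.boundary M₂, ∀ n : TangentSpace I y, IsInwardNormal I y n →
    a (p y) • nab.lift hp y n η + b (p y) • η.1 y = 0}
  add_mem' {η θ} hη hθ y hy n hn := by
    have := congrArg₂ (· + ·) (hη y hy n hn) (hθ y hy n hn)
    simp only [add_zero] at this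
    rw [map_add, smul_add]
    change _ + b (p y) • (η.1 y + θ.1 y) = 0
    rw [smul_add, ← this]
    abel
  zero_mem' y hy n hn := by
    rw [map_zero]
    change a (p y) • (0 : (p *ᵖ E) y) + b (p y) • (0 : (p *ᵖ E) y) = 0
    simp
  smul_mem' c η hη y hy n hn := by
    have := congrArg (c • ·) (hη y hy n hn)
    simp only [smul_zero] at this
    rw [map_smul]
    change _ + b (p y) • (c • η.1 y) = 0
    rw [← this, smul_add, smul_comm c, smul_comm c]

/-- The lift of a differential operator does not increase supports. -/
def DifferentialOperator.liftCompact [T2Space M₂] (D : DifferentialOperator I 𝕜 F E)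
    (hp : IsLocalDiffeomorph I I ∞ p) :
    compactlySupportedSections I 𝕜 F (p *ᵖ E) →ₗ[𝕜] compactlySupportedSections I 𝕜 F (p *ᵖ E) :=
  (D.lift hp).restrict fun η hη ↦ by
    refine IsCompact.of_isClosed_subset hη isClosed_closure
      (closure_minimal (fun y hy ↦ ?_) isClosed_closure)
    by_contra h
    refine hy ?_
    have h0 : ∀ᶠ z in 𝓝 y, η.1 z = 0 := by
      filter_upwards [isClosed_closure.isOpen_compl.mem_nhds h] with z hz
      by_contra hne
      exact hz (subset_closure hne)
    have h1 : (D.toLinearMap (descend hp η y)).1 (p y) = (D.toLinearMap 0).1 (p y) := by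
      refine D.congr (eventually_eq_of_pullback hp ?_)
      filter_upwards [h0, descend_spec hp η y] with z h1 h2
      exact h2.trans h1
    rw [map_zero] at h1
    exact h1

end Domain

/-! ### The Hilbert space of square integrable sections -/

section L2

variable {m : ℕ} {H : Type*} [TopologicalSpace H]
  {I : ModelWithCorners ℝ (EuclideanSpace ℝ (Fin m)) H}
  {M : Type*} [TopologicalSpace M] [ChartedSpace H M]
  {𝕜 : Type*} [RCLike 𝕜]
  {F : Type*} [NormedAddCommGroup F] [NormedSpace ℝ F] [NormedSpace 𝕜 F] [IsScalarTower ℝ 𝕜 F]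
  {E : M → Type*} [∀ x, AddCommGroup (E x)] [∀ x, Module ℝ (E x)] [∀ x, Module 𝕜 (E x)]
  [∀ x, TopologicalSpace (E x)] [TopologicalSpace (TotalSpace F E)] [FiberBundle F E]
  [VectorBundle ℝ F E] [VectorBundle 𝕜 F E] [ContMDiffVectorBundle ∞ F E I]

/-- The space `Γ_c(E)`, considered with the `L²`-inner product induced by the metric `h` on `E`
and the Riemannian volume. -/
def PreL2 (_h : HermitianMetric I 𝕜 F E) : Type _ :=
  compactlySupportedSections I 𝕜 F E

variable (h : HermitianMetric I 𝕜 F E)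

instance : AddCommGroup (PreL2 h) :=
  inferInstanceAs (AddCommGroup (compactlySupportedSections I 𝕜 F E))

instance : Module 𝕜 (PreL2 h) :=
  inferInstanceAs (Module 𝕜 (compactlySupportedSections I 𝕜 F E))

lemma hasCompactSupport_inner [T2Space M] (s t : PreL2 h) :
    HasCompactSupport fun x ↦ h.inner x (s.1.1 x) (t.1.1 x) := by
  refine IsCompact.of_isClosed_subset s.2 isClosed_closure (closure_mono fun x hx h0 ↦ hx ?_)
  simp [h0]

variable [FiniteDimensional 𝕜 F] [T2Space M] [IsManifold I ∞ M]
  [RiemannianBundle (fun x : M ↦ TangentSpace I x)]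
  [IsContMDiffRiemannianBundle I ∞ (EuclideanSpace ℝ (Fin m)) (fun x : M ↦ TangentSpace I x)]
  [MeasurableSpace M] [BorelSpace M]

lemma integrable_inner (s t : PreL2 h) :
    Integrable (fun x ↦ h.inner x (s.1.1 x) (t.1.1 x)) (riemannianVolume I M) :=
  (h.continuous_inner s.1 t.1).integrable_of_hasCompactSupport (hasCompactSupport_inner h s t)

lemma re_inner_self_nonneg (x : M) (v : E x) : 0 ≤ RCLike.re (h.inner x v v) := by
  by_cases hv : v = 0
  · simp [hv]
  · exact (h.inner_self_pos x v hv).le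

/-- The `L²`-inner product `⟪s, t⟫ = ∫ h(s, t)` on `Γ_c(E)`. -/
abbrev preL2Core : InnerProductSpace.Core 𝕜 (PreL2 h) where
  inner s t := ∫ x, h.inner x (s.1.1 x) (t.1.1 x) ∂riemannianVolume I M
  conj_inner_symm s t := by
    rw [← integral_conj]
    exact integral_congr_ae (ae_of_all _ fun x ↦ h.conj_inner_symm x _ _)
  re_inner_nonneg s := by
    rw [← integral_re (integrable_inner h s s)]
    exact integral_nonneg fun x ↦ re_inner_self_nonneg h x _
  add_left s t u := by
    rw [← integral_add (integrable_inner h s u) (integrable_inner h t u)]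
    refine integral_congr_ae (ae_of_all _ fun x ↦ ?_)
    change h.inner x (s.1.1 x + t.1.1 x) (u.1.1 x) = _
    simp
  smul_left s t c := by
    rw [← integral_const_mul]
    refine integral_congr_ae (ae_of_all _ fun x ↦ ?_)
    change h.inner x (c • s.1.1 x) (t.1.1 x) = _
    simp
  definite s hs := by
    by_contra hne
    obtain ⟨x, hx⟩ : ∃ x, s.1.1 x ≠ 0 := by
      by_contra! h0
      exact hne (Subtype.ext (Subtype.ext (funext h0)))
    have h1 : Continuous fun x ↦ RCLike.re (h.inner x (s.1.1 x) (s.1.1 x)) :=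
      RCLike.continuous_re.comp (h.continuous_inner s.1 s.1)
    have h2 : HasCompactSupport fun x ↦ RCLike.re (h.inner x (s.1.1 x) (s.1.1 x)) :=
      (hasCompactSupport_inner h s s).comp_left (g := RCLike.re) (map_zero _)
    have h3 := h1.integral_pos_of_hasCompactSupport_nonneg_nonzero (μ := riemannianVolume I M) h2
      (fun x ↦ re_inner_self_nonneg h x _) (h.inner_self_pos x _ hx).ne'
    rw [integral_re (integrable_inner h s s)] at h3
    have h4 : (∫ x, h.inner x (s.1.1 x) (s.1.1 x) ∂riemannianVolume I M) = 0 := hs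
    rw [h4] at h3
    simp at h3

instance : NormedAddCommGroup (PreL2 h) := (preL2Core h).toNormedAddCommGroup

instance : InnerProductSpace 𝕜 (PreL2 h) := InnerProductSpace.ofCore (preL2Core h).toCore

/-- The Hilbert space `L²(E)`: the completion of `Γ_c(E)` for the `L²`-inner product. -/
abbrev L2 : Type _ := UniformSpace.Completion (PreL2 h)

end L2

/-! ### Unbounded operators -/

section Operators

variable {𝕜 : Type*} [RCLike 𝕜]

/-- The operator in the completion of `V` that is given by `T` on the subspace `V₀` of `V`. -/
def completionOp {V : Type*} [NormedAddCommGroup V] [InnerProductSpace 𝕜 V] (V₀ : Submodule 𝕜 V)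
    (T : V →ₗ[𝕜] V) : UniformSpace.Completion V →ₗ.[𝕜] UniformSpace.Completion V :=
  have hinj : Function.Injective (UniformSpace.Completion.toComplₗᵢ (𝕜 := 𝕜) (E := V)).toLinearMap :=
    (UniformSpace.Completion.toComplₗᵢ (𝕜 := 𝕜) (E := V)).injective
  { domain := V₀.map (UniformSpace.Completion.toComplₗᵢ (𝕜 := 𝕜) (E := V)).toLinearMap
    toFun := (UniformSpace.Completion.toComplₗᵢ (𝕜 := 𝕜) (E := V)).toLinearMap ∘ₗ T ∘ₗ
      V₀.subtype ∘ₗ (V₀.equivMapOfInjective _ hinj).symm.toLinearMap }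

lemma completionOp_apply {V : Type*} [NormedAddCommGroup V] [InnerProductSpace 𝕜 V]
    (V₀ : Submodule 𝕜 V) (T : V →ₗ[𝕜] V) (v : V) (hv : v ∈ V₀) :
    completionOp V₀ T ⟨(v : UniformSpace.Completion V), Submodule.mem_map_of_mem hv⟩ =
      (T v : UniformSpace.Completion V) := by
  have hinj : Function.Injective (UniformSpace.Completion.toComplₗᵢ (𝕜 := 𝕜) (E := V)).toLinearMap :=
    (UniformSpace.Completion.toComplₗᵢ (𝕜 := 𝕜) (E := V)).injective
  have h1 : (V₀.equivMapOfInjective _ hinj).symm ⟨(v : UniformSpace.Completion V),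
      Submodule.mem_map_of_mem hv⟩ = ⟨v, hv⟩ := by
    rw [LinearEquiv.symm_apply_eq]
    rfl
  exact congrArg (fun w : V₀ ↦ ((T w : V) : UniformSpace.Completion V)) h1

variable {X : Type*} [NormedAddCommGroup X] [InnerProductSpace 𝕜 X]

/-- The operator `A` is symmetric. -/
def IsSymmetricOp (A : X →ₗ.[𝕜] X) : Prop :=
  ∀ u v : A.domain, inner 𝕜 (A u) (v : X) = inner 𝕜 (u : X) (A v)

/-- The operator `A` is bounded from below: its Rayleigh quotients have a finite lower bound. -/
def IsBoundedFromBelow (A : X →ₗ.[𝕜] X) : Prop :=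
  ∃ c : ℝ, ∀ u : A.domain, u ≠ 0 → c ≤ RCLike.re (inner 𝕜 (A u) (u : X)) / ‖(u : X)‖ ^ 2

lemma IsBoundedFromBelow.exists_le {A : X →ₗ.[𝕜] X} (hA : IsBoundedFromBelow A) :
    ∃ c : ℝ, ∀ u : A.domain, 0 ≤ RCLike.re (inner 𝕜 (A u) (u : X)) - c * ‖(u : X)‖ ^ 2 := by
  obtain ⟨c, hc⟩ := hA
  refine ⟨c, fun u ↦ ?_⟩
  by_cases hu : u = 0
  · simp [hu]
  · have h1 : (0 : ℝ) < ‖(u : X)‖ ^ 2 := by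
      have : (u : X) ≠ 0 := fun h ↦ hu (Subtype.ext h)
      positivity
    have := (le_div_iff₀ h1).1 (hc u hu)
    linarith

lemma IsBoundedFromBelow.re_inner_add_le {A : X →ₗ.[𝕜] X} {c : ℝ}
    (hc : ∀ u : A.domain, 0 ≤ RCLike.re (inner 𝕜 (A u) (u : X)) - c * ‖(u : X)‖ ^ 2)
    (x y : A.domain) :
    RCLike.re (inner 𝕜 (A (x + y)) ((x + y : A.domain) : X)) ≤
      2 * (RCLike.re (inner 𝕜 (A x) (x : X)) - c * ‖(x : X)‖ ^ 2) +
      2 * (RCLike.re (inner 𝕜 (A y) (y : X)) - c * ‖(y : X)‖ ^ 2) +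
      c * ‖(x : X) + y‖ ^ 2 := by
  have h1 := hc (x - y)
  have h2 : RCLike.re (inner 𝕜 (A (x + y)) ((x + y : A.domain) : X)) +
      RCLike.re (inner 𝕜 (A (x - y)) ((x - y : A.domain) : X)) =
      2 * RCLike.re (inner 𝕜 (A x) (x : X)) + 2 * RCLike.re (inner 𝕜 (A y) (y : X)) := by
    rw [A.map_add, A.map_sub, Submodule.coe_add, Submodule.coe_sub]
    simp only [inner_add_left, inner_add_right, inner_sub_left, inner_sub_right, map_add, map_sub]
    ring
  have h3 := parallelogram_law_with_norm 𝕜 (x : X) (y : X)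
  rw [Submodule.coe_sub] at h1
  have h4 : c * ‖(x : X) + y‖ ^ 2 + c * ‖(x : X) - y‖ ^ 2 =
      2 * (c * ‖(x : X)‖ ^ 2) + 2 * (c * ‖(y : X)‖ ^ 2) := by
    linear_combination c * h3
  rw [Submodule.coe_sub] at h2
  linarith

/-- The form domain of an operator `A` that is bounded from below: the vectors `u` that are limits
of sequences in the domain of `A` which are Cauchy for the form `⟪A v, v⟫`. -/
def formDomain (A : X →ₗ.[𝕜] X) (hA : IsBoundedFromBelow A) : Submodule 𝕜 X where
  carrier := {u | ∃ v : ℕ → A.domain, Tendsto (fun k ↦ (v k : X)) atTop (𝓝 u) ∧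
    Tendsto (fun k : ℕ × ℕ ↦ RCLike.re (inner 𝕜 (A (v k.1 - v k.2)) ((v k.1 - v k.2 : A.domain) : X)))
      atTop (𝓝 0)}
  add_mem' := by
    rintro u u' ⟨v, hv, hv0⟩ ⟨w, hw, hw0⟩
    refine ⟨fun k ↦ v k + w k, by simpa using! hv.add hw, ?_⟩
    obtain ⟨c, hc⟩ := hA.exists_le
    have hcau : ∀ {v : ℕ → A.domain} {u : X}, Tendsto (fun k ↦ (v k : X)) atTop (𝓝 u) →
        Tendsto (fun k : ℕ × ℕ ↦ (v k.1 : X) - v k.2) atTop (𝓝 0) := fun {v u} hv ↦ by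
      rw [← prod_atTop_atTop_eq, ← sub_self u]
      exact (hv.comp tendsto_fst).sub (hv.comp tendsto_snd)
    have h1 := (hcau hv).norm.pow 2
    have h2 := (hcau hw).norm.pow 2
    have h3 := ((hcau hv).add (hcau hw)).norm.pow 2
    simp only [norm_zero, add_zero, ne_eq, OfNat.ofNat_ne_zero, not_false_eq_true, zero_pow]
      at h1 h2 h3
    have hlow := h3.const_mul c
    have hup := (((hv0.sub (h1.const_mul c)).const_mul 2).add
      ((hw0.sub (h2.const_mul c)).const_mul 2)).add (h3.const_mul c)
    simp only [mul_zero, sub_zero, add_zero] at hlow hup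
    refine tendsto_of_tendsto_of_tendsto_of_le_of_le hlow hup (fun k ↦ ?_) (fun k ↦ ?_)
    · have := hc (v k.1 + w k.1 - (v k.2 + w k.2))
      have he : ((v k.1 + w k.1 - (v k.2 + w k.2) : A.domain) : X) =
          (v k.1 : X) - v k.2 + ((w k.1 : X) - w k.2) := by
        push_cast; abel
      simp only [he] at this ⊢
      linarith
    · have hx : v k.1 + w k.1 - (v k.2 + w k.2) = (v k.1 - v k.2) + (w k.1 - w k.2) := by abel
      rw [hx]
      simpa using IsBoundedFromBelow.re_inner_add_le hc (v k.1 - v k.2) (w k.1 - w k.2)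
  zero_mem' := ⟨fun _ ↦ 0, by simp, by simp⟩
  smul_mem' := by
    rintro a u ⟨v, hv, hv0⟩
    refine ⟨fun k ↦ a • v k, by simpa using! hv.const_smul a, ?_⟩
    have h1 := hv0.const_mul (‖a‖ ^ 2)
    rw [mul_zero] at h1
    refine h1.congr fun k ↦ ?_
    rw [← smul_sub, A.map_smul, Submodule.coe_smul, inner_smul_left, inner_smul_right, ← mul_assoc,
      RCLike.conj_mul, ← RCLike.ofReal_pow, RCLike.re_ofReal_mul]

/-- The Friedrichs extension of a (densely defined, symmetric) operator that is bounded from below: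
the restriction of the adjoint to the vectors in the form domain. -/
def friedrichsExtension [CompleteSpace X] (A : X →ₗ.[𝕜] X) (hA : IsBoundedFromBelow A) :
    X →ₗ.[𝕜] X :=
  A.adjoint.domRestrict (formDomain A hA)

/-- The map `A - μ` from the domain of `A` to the Hilbert space. -/
def subScalar (A : X →ₗ.[𝕜] X) (μ : 𝕜) : A.domain →ₗ[𝕜] X :=
  A.toFun - μ • A.domain.subtype

/-- The spectrum of an operator. -/
def spectrumOf (A : X →ₗ.[𝕜] X) : Set 𝕜 :=
  {μ | ¬ Function.Bijective (subScalar A μ)}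

/-- A linear map is Fredholm if its kernel is finite-dimensional and its range is closed and of
finite codimension. -/
structure IsFredholmMap {Y : Type*} [AddCommGroup Y] [Module 𝕜 Y] (T : Y →ₗ[𝕜] X) : Prop where
  finiteDimensional_ker : FiniteDimensional 𝕜 (LinearMap.ker T)
  isClosed_range : IsClosed (LinearMap.range T : Set X)
  finiteDimensional_coker : FiniteDimensional 𝕜 (X ⧸ LinearMap.range T)

/-- The essential spectrum of an operator. -/
def essentialSpectrum (A : X →ₗ.[𝕜] X) : Set 𝕜 :=
  {μ | ¬ IsFredholmMap (subScalar A μ)}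

/-- The number `μ` is an eigenvalue of finite multiplicity of the operator `A`. -/
structure IsEigenvalueOfFiniteMultiplicity (A : X →ₗ.[𝕜] X) (μ : 𝕜) : Prop where
  exists_eigenvector : ∃ u : A.domain, u ≠ 0 ∧ A u = μ • (u : X)
  finiteDimensional : FiniteDimensional 𝕜 (LinearMap.ker (subScalar A μ))

end Operators

/-! ### The lifted operator as an unbounded operator -/

section Main

variable {m : ℕ} {H : Type*} [TopologicalSpace H]
  {I : ModelWithCorners ℝ (EuclideanSpace ℝ (Fin m)) H}
  {M₁ M₂ : Type*} [TopologicalSpace M₁] [ChartedSpace H M₁] [TopologicalSpace M₂]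
  [ChartedSpace H M₂] [IsManifold I ∞ M₁] [T2Space M₁] [IsManifold I ∞ M₂] [T2Space M₂]
  [RiemannianBundle (fun x : M₁ ↦ TangentSpace I x)]
  [RiemannianBundle (fun y : M₂ ↦ TangentSpace I y)]
  [IsContMDiffRiemannianBundle I ∞ (EuclideanSpace ℝ (Fin m)) (fun y : M₂ ↦ TangentSpace I y)]
  [MeasurableSpace M₂] [BorelSpace M₂]
  {𝕜 : Type*} [RCLike 𝕜]
  {F : Type*} [NormedAddCommGroup F] [NormedSpace ℝ F] [NormedSpace 𝕜 F] [IsScalarTower ℝ 𝕜 F]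
  [FiniteDimensional 𝕜 F]
  {E : M₁ → Type*} [∀ x, AddCommGroup (E x)] [∀ x, Module ℝ (E x)] [∀ x, Module 𝕜 (E x)]
  [∀ x, TopologicalSpace (E x)] [∀ x, IsTopologicalAddGroup (E x)] [∀ x, ContinuousSMul ℝ (E x)]
  [TopologicalSpace (TotalSpace F E)] [FiberBundle F E]
  [VectorBundle ℝ F E] [VectorBundle 𝕜 F E] [ContMDiffVectorBundle ∞ F E I]
  {p : C^∞⟮I, M₂; I, M₁⟯}

/-- The lift `D₂` of `D`, as an unbounded operator in `L²(E₂)`, where `E₂ = p^*E`. Its domain is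
the space of compactly supported smooth sections of `E₂` that satisfy the boundary condition
`a₂ ∇_n η + b₂ η = 0` on `∂M₂`, where `a₂ = a ∘ p` and `b₂ = b ∘ p`. -/
def liftedOperator (hp : IsRiemannianCovering I p) (h : HermitianMetric I 𝕜 F E)
    (nab : Connection I 𝕜 F E) (D : DifferentialOperator I 𝕜 F E) (a b : M₁ → 𝕜) :
    L2 (h.pullback p) →ₗ.[𝕜] L2 (h.pullback p) :=
  completionOp (V := PreL2 (h.pullback p))
    ((boundaryCondition nab hp.isLocalDiffeomorph a b).comap
      (compactlySupportedSections I 𝕜 F (p *ᵖ E)).subtype)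
    (D.liftCompact hp.isLocalDiffeomorph)

end Main

end RiemannianCovering

open RiemannianCovering

set_option linter.unusedSectionVars false

namespace RiemannianCovering

/-! ### Operators commuting with unitary operators -/

section Unitary

variable {𝕜 : Type*} [RCLike 𝕜] {X : Type*} [NormedAddCommGroup X] [InnerProductSpace 𝕜 X]

/-! The deck group acts on `L²(E₂)` by unitary operators `U g`, the pullbacks of sections, and
everything that defines the operator is lifted from `M₁`, hence invariant under this action. Since
the group is infinite and acts properly discontinuously, `U g` pushes sections off to infinity: for
compactly supported `s` and `t`, the sections `g^* s` and `t` have overlapping supports for only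
finitely many `g`. By density, `⟪U g u, v⟫ → 0` along the cofinite filter for all `u`, `v` in
`L²(E₂)`.

Such a family has no nonzero finite-dimensional invariant subspace `W`: for `w ∈ W`, the squares of
the finitely many coefficients of `U g w` in an orthonormal basis of `W` add up to `‖w‖²`, yet each
tends to zero (`eq_bot_of_finiteDimensional_of_invariant`). This is applied twice to an operator `A`
commuting with all `U g` and their inverses. The kernel of `A - μ` is invariant, so it is zero as
soon as it is finite-dimensional, which excludes eigenvalues of finite multiplicity. The orthogonal
complement of the range of `A - μ` is invariant too, and it is finite-dimensional if `A - μ` is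
Fredholm. Hence a Fredholm `A - μ` is injective with closed dense range, that is, bijective. The
converse is immediate, so spectrum and essential spectrum agree.

What remains is that the Friedrichs extension commutes with `U g`. It is built from the operator by
taking the adjoint and the form domain, and both constructions respect unitary symmetries. So it
suffices that `g^*` preserves the `L²`-product, which holds because deck transformations are
isometries, that it commutes with the lift of `D`, and that it preserves the boundary condition. The
last two hold because a local descent of `η` near `g y` is also a local descent of `g^* η` near `y`
(`descent_deckPullback`), and because isometries carry inward unit normals to inward unit normals.
-/

/-- The unitary operator `U` maps the domain of `A` into itself and commutes with `A` there. -/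
def CommutesWith (A : X →ₗ.[𝕜] X) (U : X ≃ₗᵢ[𝕜] X) : Prop :=
  ∀ u : A.domain, ∃ hu : U u ∈ A.domain, A ⟨U u, hu⟩ = U (A u)

lemma inner_map_eq_inner_symm (U : X ≃ₗᵢ[𝕜] X) (u v : X) :
    inner 𝕜 (U u) v = inner 𝕜 u (U.symm v) := by
  rw [← U.inner_map_map u, U.apply_symm_apply]

/-- For `x` in the domain, `⟪U y, A x⟫ = ⟪y, U⁻¹ A x⟫ = ⟪y, A U⁻¹ x⟫`. This is why the hypothesis
concerns `U.symm`: the functional of `U y` is the functional of `y` composed with the continuous map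
`U⁻¹` of the domain. -/
lemma CommutesWith.adjoint [CompleteSpace X] {A : X →ₗ.[𝕜] X} {U : X ≃ₗᵢ[𝕜] X}
    (hU : CommutesWith A U.symm) : CommutesWith A.adjoint U := by
  intro y
  have hmem : U y ∈ A.adjoint.domain := by
    have hy := (A.mem_adjoint_domain_iff y).1 y.2
    rw [A.mem_adjoint_domain_iff]
    have h1 : Continuous fun x : A.domain ↦ (⟨U.symm x, (hU x).1⟩ : A.domain) :=
      (U.symm.continuous.comp continuous_subtype_val).subtype_mk _
    refine (hy.comp h1).congr fun x ↦ ?_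
    change inner 𝕜 (y : X) (A ⟨U.symm x, (hU x).1⟩) = inner 𝕜 (U y) (A x)
    rw [(hU x).2, inner_map_eq_inner_symm]
  refine ⟨hmem, ?_⟩
  by_cases hA : Dense (A.domain : Set X)
  · refine LinearPMap.adjoint_apply_eq hA _ fun x ↦ ?_
    rw [inner_map_eq_inner_symm]
    refine (LinearPMap.adjoint_isFormalAdjoint hA y ⟨U.symm x, (hU x).1⟩).trans ?_
    rw [(hU x).2, inner_map_eq_inner_symm]
  -- If the domain is not dense, the adjoint takes the value zero by convention, so both sides
  -- vanish.
  · rw [LinearPMap.adjoint_apply_of_not_dense hA, LinearPMap.adjoint_apply_of_not_dense hA,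
      map_zero]

/-- Apply `U` to an approximating sequence: the quadratic form takes the same values on the images
of differences. -/
lemma CommutesWith.map_mem_formDomain {A : X →ₗ.[𝕜] X} {hA : IsBoundedFromBelow A}
    {U : X ≃ₗᵢ[𝕜] X} (hU : CommutesWith A U) {u : X} (hu : u ∈ formDomain A hA) :
    U u ∈ formDomain A hA := by
  obtain ⟨v, hv, hv0⟩ := hu
  refine ⟨fun k ↦ ⟨U (v k), (hU (v k)).1⟩, (U.continuous.tendsto u).comp hv, ?_⟩
  refine hv0.congr fun k ↦ ?_
  have h1 : (⟨U (v k.1), (hU (v k.1)).1⟩ - ⟨U (v k.2), (hU (v k.2)).1⟩ : A.domain) =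
      ⟨U (v k.1 - v k.2 : A.domain), (hU (v k.1 - v k.2)).1⟩ :=
    Subtype.ext (U.map_sub _ _).symm
  rw [h1, (hU (v k.1 - v k.2)).2, U.inner_map_map]

/-- Both hypotheses matter: commutation with `U` moves the form domain, commutation with `U⁻¹` moves
the adjoint. -/
lemma CommutesWith.friedrichsExtension [CompleteSpace X] {A : X →ₗ.[𝕜] X}
    (hA : IsBoundedFromBelow A) {U : X ≃ₗᵢ[𝕜] X} (hU : CommutesWith A U)
    (hU' : CommutesWith A U.symm) : CommutesWith (friedrichsExtension A hA) U := by
  intro u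
  obtain ⟨h1, h2⟩ := hU'.adjoint ⟨u, u.2.2⟩
  exact ⟨⟨hU.map_mem_formDomain u.2.1, h1⟩, h2⟩

/-- A finite-dimensional subspace that is invariant under a weakly mixing family of unitary
operators is trivial. -/
lemma eq_bot_of_finiteDimensional_of_invariant {G : Type*} [Infinite G] {U : G → X ≃ₗᵢ[𝕜] X}
    (hU : ∀ u v, Tendsto (fun g ↦ inner 𝕜 (U g u) v) cofinite (𝓝 0)) (W : Submodule 𝕜 X)
    [FiniteDimensional 𝕜 W] (hW : ∀ g, ∀ w ∈ W, U g w ∈ W) : W = ⊥ := by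
  refine (Submodule.eq_bot_iff _).2 fun w hw ↦ ?_
  have h1 : ∀ g, ∑ i, ‖inner 𝕜 (U g w) (stdOrthonormalBasis 𝕜 W i : X)‖ ^ 2 = ‖w‖ ^ 2 := fun g ↦ by
    have := (stdOrthonormalBasis 𝕜 W).sum_sq_norm_inner_left ⟨U g w, hW g w hw⟩
    simpa using! this
  have h2 : Tendsto (fun g ↦ ∑ i, ‖inner 𝕜 (U g w) (stdOrthonormalBasis 𝕜 W i : X)‖ ^ 2) cofinite
      (𝓝 (∑ _i : Fin (Module.finrank 𝕜 W), (0 : ℝ))) := by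
    refine tendsto_finsetSum _ fun i _ ↦ ?_
    simpa using (hU w (stdOrthonormalBasis 𝕜 W i : X)).norm.pow 2
  simp only [h1, Finset.sum_const_zero] at h2
  -- The constant `‖w‖²` converges to `0` along the cofinite filter, which is nontrivial because `G`
  -- is infinite.
  simpa using tendsto_nhds_unique tendsto_const_nhds h2

lemma CommutesWith.exists_subScalar {A : X →ₗ.[𝕜] X} {U : X ≃ₗᵢ[𝕜] X} (hU : CommutesWith A U)
    (μ : 𝕜) (u : A.domain) :
    ∃ v : A.domain, (v : X) = U u ∧ subScalar A μ v = U (subScalar A μ u) := by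
  obtain ⟨h1, h2⟩ := hU u
  refine ⟨⟨U u, h1⟩, rfl, ?_⟩
  change A ⟨U u, h1⟩ - μ • U u = U (A u - μ • (u : X))
  rw [h2, map_sub, map_smul]

variable {G : Type*} [Infinite G] {U : G → X ≃ₗᵢ[𝕜] X} {A : X →ₗ.[𝕜] X}

/-- The kernel is a subspace of the domain of `A`, whereas the operators `U g` act on `X`, so the
invariance argument is run on its image in `X`. -/
lemma ker_subScalar_eq_bot (hU : ∀ u v, Tendsto (fun g ↦ inner 𝕜 (U g u) v) cofinite (𝓝 0))
    (hA : ∀ g, CommutesWith A (U g)) (μ : 𝕜) [FiniteDimensional 𝕜 (LinearMap.ker (subScalar A μ))] :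
    LinearMap.ker (subScalar A μ) = ⊥ := by
  have h1 : (LinearMap.ker (subScalar A μ)).map A.domain.subtype = ⊥ := by
    refine eq_bot_of_finiteDimensional_of_invariant hU _ ?_
    rintro g _ ⟨u, hu, rfl⟩
    obtain ⟨v, hv, hv'⟩ := (hA g).exists_subScalar μ u
    refine ⟨v, ?_, hv⟩
    rw [SetLike.mem_coe, LinearMap.mem_ker] at hu ⊢
    rw [hv', hu, map_zero]
  exact Submodule.map_injective_of_injective A.domain.subtype_injective
    (h1.trans (Submodule.map_bot _).symm)

/-- An operator commuting with a weakly mixing family of unitary operators has no eigenvalues of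
finite multiplicity. -/
theorem not_isEigenvalueOfFiniteMultiplicity
    (hU : ∀ u v, Tendsto (fun g ↦ inner 𝕜 (U g u) v) cofinite (𝓝 0))
    (hA : ∀ g, CommutesWith A (U g)) (μ : 𝕜) : ¬ IsEigenvalueOfFiniteMultiplicity A μ := by
  rintro ⟨⟨u, hu, hAu⟩, hfin⟩
  refine hu ((Submodule.mem_bot 𝕜).1 ?_)
  rw [← ker_subScalar_eq_bot hU hA μ, LinearMap.mem_ker]
  exact sub_eq_zero.2 hAu

lemma range_subScalar_eq_top [CompleteSpace X]
    (hU : ∀ u v, Tendsto (fun g ↦ inner 𝕜 (U g u) v) cofinite (𝓝 0))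
    (hA : ∀ g, CommutesWith A (U g).symm) {μ : 𝕜} (hμ : IsFredholmMap (subScalar A μ)) :
    LinearMap.range (subScalar A μ) = ⊤ := by
  set R := LinearMap.range (subScalar A μ) with hR
  have := hμ.finiteDimensional_coker
  -- `Rᗮ` meets `R` only in zero, so it embeds into the quotient by `R`.
  have : FiniteDimensional 𝕜 Rᗮ := by
    refine FiniteDimensional.of_injective (R.mkQ ∘ₗ Rᗮ.subtype) ?_
    rw [← LinearMap.ker_eq_bot, LinearMap.ker_eq_bot']
    intro w hw
    have h1 : (w : X) ∈ R := by simpa using hw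
    exact Subtype.ext (inner_self_eq_zero.1 (w.2 w h1))
  have h1 : Rᗮ = ⊥ := by
    -- `R` is invariant under `(U g)⁻¹`, hence `Rᗮ` is invariant under `U g`.
    refine eq_bot_of_finiteDimensional_of_invariant hU _ fun g w hw ↦ ?_
    rw [Submodule.mem_orthogonal'] at hw ⊢
    rintro _ ⟨u, rfl⟩
    obtain ⟨v, -, hv⟩ := (hA g).exists_subScalar μ u
    rw [inner_map_eq_inner_symm, ← hv]
    exact hw _ ⟨v, rfl⟩
  have h2 := Submodule.topologicalClosure_eq_top_iff.2 h1
  rwa [hμ.isClosed_range.submodule_topologicalClosure_eq] at h2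

/-- The spectrum of an operator commuting with a weakly mixing family of unitary operators is
equal to its essential spectrum. -/
theorem spectrumOf_eq_essentialSpectrum [CompleteSpace X]
    (hU : ∀ u v, Tendsto (fun g ↦ inner 𝕜 (U g u) v) cofinite (𝓝 0))
    (hA : ∀ g, CommutesWith A (U g)) (hA' : ∀ g, CommutesWith A (U g).symm) :
    spectrumOf A = essentialSpectrum A := by
  ext μ
  refine not_congr ⟨fun h ↦ ?_, fun h ↦ ?_⟩
  · have hr : LinearMap.range (subScalar A μ) = ⊤ := LinearMap.range_eq_top.2 h.2
    refine ⟨?_, ?_, ?_⟩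
    · rw [LinearMap.ker_eq_bot.2 h.1]
      infer_instance
    · simp [hr]
    · rw [hr]
      infer_instance
  · have := h.finiteDimensional_ker
    exact ⟨LinearMap.ker_eq_bot.1 (ker_subScalar_eq_bot hU hA μ),
      LinearMap.range_eq_top.1 (range_subScalar_eq_top hU hA' h)⟩

end Unitary

/-! ### Unitary operators on the completion -/

section Completion

open UniformSpace

variable {𝕜 : Type*} [RCLike 𝕜] {V : Type*} [NormedAddCommGroup V] [InnerProductSpace 𝕜 V]

/-- The unitary operator on the completion of `V` that extends a unitary operator on `V`. -/
def completionIsometry (U : V ≃ₗᵢ[𝕜] V) : Completion V ≃ₗᵢ[𝕜] Completion V :=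
  U.toLinearEquiv.extendOfIsometry (Completion.toComplₗᵢ (𝕜 := 𝕜) (E := V)).toLinearMap
    (Completion.toComplₗᵢ (𝕜 := 𝕜) (E := V)).toLinearMap Completion.denseRange_coe
    Completion.denseRange_coe fun x ↦ by simp

lemma completionIsometry_coe (U : V ≃ₗᵢ[𝕜] V) (v : V) :
    completionIsometry U (v : Completion V) = (U v : Completion V) :=
  LinearEquiv.extendOfIsometry_eq U.toLinearEquiv (Completion.toComplₗᵢ (𝕜 := 𝕜) (E := V)).toLinearMap
    (Completion.toComplₗᵢ (𝕜 := 𝕜) (E := V)).toLinearMap _ _ _ v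

lemma completionIsometry_symm_coe (U : V ≃ₗᵢ[𝕜] V) (v : V) :
    (completionIsometry U).symm (v : Completion V) = (U.symm v : Completion V) := by
  rw [LinearIsometryEquiv.symm_apply_eq, completionIsometry_coe, U.apply_symm_apply]

/-- `W` is only required to extend `U`, so that the lemma applies both to `completionIsometry` and
to its inverse. -/
lemma commutesWith_completionOp {V₀ : Submodule 𝕜 V} {T : V →ₗ[𝕜] V} {U : V ≃ₗᵢ[𝕜] V}
    {W : Completion V ≃ₗᵢ[𝕜] Completion V} (hW : ∀ v : V, W v = (U v : Completion V))
    (hV₀ : ∀ v ∈ V₀, U v ∈ V₀) (hT : ∀ v, T (U v) = U (T v)) :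
    CommutesWith (completionOp V₀ T) W := by
  rintro ⟨_, v, hv, rfl⟩
  have h1 : W (v : Completion V) = (U v : Completion V) := hW v
  have h2 : (U v : Completion V) ∈ (completionOp V₀ T).domain :=
    Submodule.mem_map_of_mem (hV₀ v hv)
  refine ⟨h1 ▸ h2, ?_⟩
  refine Eq.trans ?_ (congrArg W (completionOp_apply V₀ T v hv).symm)
  refine Eq.trans ?_ (hW (T v)).symm
  rw [← hT, ← completionOp_apply V₀ T (U v) (hV₀ v hv)]
  exact congrArg (completionOp V₀ T) (Subtype.ext h1)

/-- Unitary operators on `V` whose matrix coefficients are eventually zero extend to a weakly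
mixing family on the completion. -/
lemma tendsto_inner_completionIsometry {G : Type*} {U : G → V ≃ₗᵢ[𝕜] V}
    (hU : ∀ u v, {g | inner 𝕜 (U g u) v ≠ 0}.Finite) (u v : Completion V) :
    Tendsto (fun g ↦ inner 𝕜 (completionIsometry (U g) u) v) cofinite (𝓝 0) := by
  rw [Metric.tendsto_nhds]
  intro ε hε
  -- The summand `1` avoids division by zero. The vector `u'` is chosen first, since the tolerance
  -- for `v'` depends on `‖u'‖`.
  have hc : 0 < ε / (2 * (‖v‖ + 1)) := by positivity
  obtain ⟨_, hu', ⟨u', rfl⟩⟩ := Metric.dense_iff.1 (Completion.denseRange_coe (α := V)) u _ hc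
  have hc' : 0 < ε / (2 * (‖u'‖ + 1)) := by positivity
  obtain ⟨_, hv', ⟨v', rfl⟩⟩ := Metric.dense_iff.1 (Completion.denseRange_coe (α := V)) v _ hc'
  have hfin : ∀ᶠ g in cofinite, inner 𝕜 (U g u') v' = 0 := by
    simpa [Filter.eventually_cofinite] using hU u' v'
  filter_upwards [hfin] with g hg
  rw [Metric.mem_ball, dist_eq_norm, norm_sub_rev] at hu' hv'
  -- As `⟪U g u', v'⟫ = 0`, replacing `u` by `u'` and then `v` by `v'` leaves two error terms, each
  -- less than `ε / 2`.
  have h1 : inner 𝕜 (completionIsometry (U g) u) v =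
      inner 𝕜 (completionIsometry (U g) (u - u')) v +
        inner 𝕜 (completionIsometry (U g) u') (v - v') := by
    have h2 : inner 𝕜 (completionIsometry (U g) (u' : Completion V)) (v' : Completion V) = 0 := by
      rw [completionIsometry_coe, Completion.inner_coe, hg]
    rw [map_sub, inner_sub_left, inner_sub_right, h2]
    ring
  rw [dist_zero_right, h1]
  have h2 : ‖inner 𝕜 (completionIsometry (U g) (u - u')) v‖ ≤ ε / (2 * (‖v‖ + 1)) * ‖v‖ := by
    refine (norm_inner_le_norm _ _).trans ?_
    rw [LinearIsometryEquiv.norm_map]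
    gcongr
  have h3 : ‖inner 𝕜 (completionIsometry (U g) (u' : Completion V)) (v - v')‖ ≤
      ‖u'‖ * (ε / (2 * (‖u'‖ + 1))) := by
    refine (norm_inner_le_norm _ _).trans ?_
    rw [LinearIsometryEquiv.norm_map, Completion.norm_coe]
    gcongr
  have h4 : ∀ r : ℝ, 0 ≤ r → ε / (2 * (r + 1)) * r < ε / 2 := fun r hr ↦ by
    rw [div_mul_eq_mul_div, div_lt_div_iff₀ (by positivity) two_pos]
    nlinarith
  refine (norm_add_le _ _).trans_lt ?_
  have h5 := h4 ‖v‖ (norm_nonneg v)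
  have h6 := h4 ‖u'‖ (norm_nonneg u')
  linarith

end Completion

/-! ### Proper discontinuity of the group of deck transformations -/

section Deck

/-- `H` is homeomorphic to the convex set `range I`, and balls meet a convex set in convex, hence
connected, sets. Local connectedness then passes to the manifold, where uniqueness of lifts is
applied on connected neighbourhoods. -/
lemma locallyConnectedSpace_of_modelWithCorners {V H : Type*} [NormedAddCommGroup V]
    [NormedSpace ℝ V] [TopologicalSpace H] (I : ModelWithCorners ℝ V H) :
    LocallyConnectedSpace H := by
  refine locallyConnectedSpace_of_connected_bases (fun x (r : ℝ) ↦ I ⁻¹' Metric.ball (I x) r)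
    (fun _ r ↦ 0 < r) (fun x ↦ ?_) (fun x r _ ↦ ?_)
  · rw [I.isClosedEmbedding.isInducing.nhds_eq_comap]
    exact Metric.nhds_basis_ball.comap I
  · have h1 : I ⁻¹' Metric.ball (I x) r = I.symm '' (Metric.ball (I x) r ∩ range I) := by
      ext z
      constructor
      · exact fun hz ↦ ⟨I z, ⟨hz, mem_range_self z⟩, I.left_inv z⟩
      · rintro ⟨_, ⟨hz, w, rfl⟩, rfl⟩
        rwa [I.left_inv]
    rw [h1]
    exact ((convex_ball _ _).inter I.convex_range).isPreconnected.image _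
      I.continuous_symm.continuousOn

variable {X Y : Type*} [TopologicalSpace X] [TopologicalSpace Y] [T2Space Y]
  [LocallyConnectedSpace X] [PreconnectedSpace X] {p : X → Y}

/-- If `p x ≠ p z`, disjoint neighbourhoods of the images rule out every `g`, because `g` preserves
fibres. Otherwise, take a local inverse of `p` near `z` and a connected `W` around `x`. If `g` moves
some point of `W` into the domain of the local homeomorphism, then on all of `W` it equals the local
inverse composed with `p`, by uniqueness of lifts. Two such `g` agree at `x`, and therefore
everywhere. -/
lemma exists_nhds_deck_subsingleton (hp : IsCoveringMap p) (x z : X) :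
    ∃ W ∈ 𝓝 x, ∃ V ∈ 𝓝 z,
      {g : deckTransformationGroup p | ∃ w ∈ W, g.1 w ∈ V}.Subsingleton := by
  by_cases hxz : p x = p z
  · obtain ⟨e, hz, he⟩ := hp.isLocalHomeomorph z
    have hx : p ⁻¹' e.target ∈ 𝓝 x := hp.continuous.continuousAt.preimage_mem_nhds
      (e.open_target.mem_nhds (by rw [hxz, he]; exact e.map_source hz))
    obtain ⟨W, ⟨hWo, hxW, hWc⟩, hW⟩ :=
      (LocallyConnectedSpace.open_connected_basis x).mem_iff.1 hx
    have key : ∀ g : deckTransformationGroup p, (∃ w ∈ W, g.1 w ∈ e.source) →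
        EqOn g.1 (e.symm ∘ p) W := by
      rintro g ⟨w, hw, hgw⟩
      refine hp.eqOn_of_comp_eqOn hWc.isPreconnected g.1.continuous.continuousOn
        (e.continuousOn_symm.comp hp.continuous.continuousOn hW) (fun v hv ↦ ?_) hw ?_
      · exact (g.2 v).trans ((congrFun he _).trans (e.right_inv (hW hv))).symm
      · rw [Function.comp_apply, ← g.2 w, congrFun he (g.1 w), e.left_inv hgw]
    refine ⟨W, hWo.mem_nhds hxW, e.source, e.open_source.mem_nhds hz, fun g hg k hk ↦ ?_⟩
    refine Subtype.ext (Homeomorph.ext fun y ↦ congrFun (hp.eq_of_comp_eq g.1.continuous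
      k.1.continuous (funext fun v ↦ (g.2 v).trans (k.2 v).symm) x ?_) y)
    exact (key g hg hxW).trans (key k hk hxW).symm
  · obtain ⟨A, B, hA, hB, hxA, hzB, hAB⟩ := t2_separation hxz
    refine ⟨p ⁻¹' A, (hA.preimage hp.continuous).mem_nhds hxA, p ⁻¹' B,
      (hB.preimage hp.continuous).mem_nhds hzB, ?_⟩
    rintro g ⟨w, hw, hgw⟩
    rw [mem_preimage, g.2 w] at hgw
    exact (disjoint_left.1 hAB hw hgw).elim

/-- The group of deck transformations acts properly discontinuously. -/
lemma finite_deck_of_isCompact (hp : IsCoveringMap p) {K L : Set X} (hK : IsCompact K)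
    (hL : IsCompact L) : {g : deckTransformationGroup p | ∃ x ∈ K, g.1 x ∈ L}.Finite := by
  -- Passing to pairs `(x, g x)` turns the claim into a compactness induction on the single set `K
  -- ×ˢ L`.
  have h1 : {g : deckTransformationGroup p | ∃ q ∈ K ×ˢ L, g.1 q.1 = q.2}.Finite := by
    refine (hK.prod hL).induction_on
      (p := fun S ↦ {g : deckTransformationGroup p | ∃ q ∈ S, g.1 q.1 = q.2}.Finite)
      (by simp) (fun S T hST hT ↦ hT.subset ?_) (fun S T hS hT ↦ (hS.union hT).subset ?_)
      (fun q _ ↦ ?_)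
    · rintro g ⟨q, hq, h⟩
      exact ⟨q, hST hq, h⟩
    · rintro g ⟨q, hq | hq, h⟩
      · exact Or.inl ⟨q, hq, h⟩
      · exact Or.inr ⟨q, hq, h⟩
    · obtain ⟨W, hW, V, hV, h⟩ := exists_nhds_deck_subsingleton hp q.1 q.2
      refine ⟨W ×ˢ V, mem_nhdsWithin_of_mem_nhds (prod_mem_nhds hW hV), h.finite.subset ?_⟩
      rintro g ⟨r, hr, hgr⟩
      exact ⟨r.1, hr.1, hgr ▸ hr.2⟩
  refine h1.subset ?_
  rintro g ⟨x, hx, hgx⟩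
  exact ⟨(x, g.1 x), ⟨hx, hgx⟩, rfl⟩

end Deck

/-! ### Isometries preserve the Riemannian volume -/

section Volume

variable {m : ℕ} {H : Type*} [TopologicalSpace H]
  {I : ModelWithCorners ℝ (EuclideanSpace ℝ (Fin m)) H}
  {M : Type*} [TopologicalSpace M] [ChartedSpace H M] [IsManifold I ∞ M]

/-- The chart `e ∘ Φ`. -/
def pullbackChart (Φ : M ≃ₘ^∞⟮I, I⟯ M) (e : OpenPartialHomeomorph M H) :
    OpenPartialHomeomorph M H :=
  Φ.toHomeomorph.transOpenPartialHomeomorph e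

lemma pullbackChart_mem_maximalAtlas (Φ : M ≃ₘ^∞⟮I, I⟯ M) {e : OpenPartialHomeomorph M H}
    (he : e ∈ IsManifold.maximalAtlas I ∞ M) :
    pullbackChart Φ e ∈ IsManifold.maximalAtlas I ∞ M := by
  refine OpenPartialHomeomorph.mem_maximalAtlas_of_contMDiffOn _ ?_ ?_
  · exact (contMDiffOn_of_mem_maximalAtlas he).comp Φ.contMDiff.contMDiffOn fun x hx ↦ hx
  · exact Φ.symm.contMDiff.comp_contMDiffOn (contMDiffOn_symm_of_mem_maximalAtlas he)

lemma inner_map_map_of_norm_map {V W : Type*} [NormedAddCommGroup V] [InnerProductSpace ℝ V]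
    [NormedAddCommGroup W] [InnerProductSpace ℝ W] (L : V →ₗ[ℝ] W) (hL : ∀ v, ‖L v‖ = ‖v‖)
    (v w : V) : inner ℝ (L v) (L w) = inner ℝ v w :=
  (⟨L, hL⟩ : V →ₗᵢ[ℝ] W).inner_map_map v w

variable [RiemannianBundle (fun x : M ↦ TangentSpace I x)]

lemma inner_mfderiv_of_norm_mfderiv {M' : Type*} [TopologicalSpace M'] [ChartedSpace H M']
    [RiemannianBundle (fun x : M' ↦ TangentSpace I x)] {f : M → M'} {x : M}
    (hf : ∀ v : TangentSpace I x, ‖mfderiv I I f x v‖ = ‖v‖) (v w : TangentSpace I x) :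
    inner ℝ (mfderiv I I f x v) (mfderiv I I f x w) = inner ℝ v w :=
  inner_map_map_of_norm_map (mfderiv I I f x).toLinearMap hf v w

/-- The coordinate frame of `e ∘ Φ` is the image under `dΦ⁻¹` of that of `e` at the same
coordinates, and `dΦ⁻¹` is isometric, so the Gram matrices coincide. -/
lemma chartDensity_pullbackChart {Φ : M ≃ₘ^∞⟮I, I⟯ M}
    (hΦ : ∀ (x : M) (v : TangentSpace I x), ‖mfderiv I I Φ.symm x v‖ = ‖v‖)
    {e : OpenPartialHomeomorph M H} (he : e ∈ IsManifold.maximalAtlas I ∞ M)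
    {y : EuclideanSpace ℝ (Fin m)} (hy : y ∈ (e.extend I).target) :
    chartDensity I (pullbackChart Φ e) y = chartDensity I e y := by
  have huy : UniqueMDiffWithinAt 𝓘(ℝ, EuclideanSpace ℝ (Fin m)) (e.extend I).target y :=
    ((uniqueDiffOn_extend_target e) y hy).uniqueMDiffWithinAt
  have h1 := mfderiv_comp_mfderivWithin (I'' := I) y
    ((Φ.symm.contMDiff ((e.extend I).symm y)).mdifferentiableAt (by simp))
    (((contMDiffOn_extend_symm_target he) y hy).mdifferentiableWithinAt (by simp)) huy
  have h2 : ∀ v, chartFrame I (pullbackChart Φ e) y v =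
      mfderiv I I Φ.symm ((e.extend I).symm y) (chartFrame I e y v) :=
    fun v ↦ congrArg (fun L ↦ L v) h1
  unfold chartDensity
  congr 2
  ext i j
  rw [Matrix.gram_apply, Matrix.gram_apply, h2, h2]
  exact inner_mfderiv_of_norm_mfderiv (hΦ _) _ _

variable [IsContMDiffRiemannianBundle I ∞ (EuclideanSpace ℝ (Fin m))
    (fun x : M ↦ TangentSpace I x)] [MeasurableSpace M] [BorelSpace M]

/-- The volume is a supremum of chart measures, so one chart `e` at a time suffices. The measure of
`A` in `e` and that of `Φ ⁻¹' A` in `e ∘ Φ` are the same integral over the same set of coordinates.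
-/
lemma riemannianVolume_le_map {Φ : M ≃ₘ^∞⟮I, I⟯ M}
    (hΦ : ∀ (x : M) (v : TangentSpace I x), ‖mfderiv I I Φ.symm x v‖ = ‖v‖) :
    riemannianVolume I M ≤ (riemannianVolume I M).map Φ := by
  refine iSup₂_le fun e he ↦ Measure.le_iff.2 fun A hA ↦ ?_
  have hm : Measurable Φ := Φ.continuous.measurable
  rw [Measure.map_apply hm hA]
  refine le_trans (le_of_eq ?_)
    (chartVolume_le_riemannianVolume (pullbackChart_mem_maximalAtlas Φ he) _)
  rw [chartVolume_apply e hA, chartVolume_apply _ (hm hA)]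
  have hset : ((pullbackChart Φ e).extend I).target ∩
      ((pullbackChart Φ e).extend I).symm ⁻¹' (Φ ⁻¹' A) =
      (e.extend I).target ∩ (e.extend I).symm ⁻¹' A := by
    have h1 : ∀ z, Φ (((pullbackChart Φ e).extend I).symm z) = (e.extend I).symm z := fun z ↦
      Φ.apply_symm_apply _
    ext z
    simp only [mem_inter_iff, mem_preimage, h1]
    rfl
  rw [hset]
  exact setLIntegral_congr_fun (measurableSet_extend_preimage e hA) fun y hy ↦ by
    rw [chartDensity_pullbackChart hΦ he hy.1]

/-- Isometries preserve the Riemannian volume. -/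
lemma measurePreserving_riemannianVolume {Φ : M ≃ₘ^∞⟮I, I⟯ M}
    (hΦ : ∀ (x : M) (v : TangentSpace I x), ‖mfderiv I I Φ x v‖ = ‖v‖)
    (hΦ' : ∀ (x : M) (v : TangentSpace I x), ‖mfderiv I I Φ.symm x v‖ = ‖v‖) :
    MeasurePreserving Φ (riemannianVolume I M) (riemannianVolume I M) := by
  have hm : Measurable Φ := Φ.continuous.measurable
  have hm' : Measurable Φ.symm := Φ.symm.continuous.measurable
  refine ⟨hm, le_antisymm ?_ (riemannianVolume_le_map hΦ')⟩
  -- The reverse inequality is the same one for `Φ.symm`, pushed forward by `Φ`.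
  have h1 : riemannianVolume I M ≤ (riemannianVolume I M).map Φ.symm :=
    riemannianVolume_le_map (Φ := Φ.symm) hΦ
  refine (Measure.map_mono h1 hm).trans (le_of_eq ?_)
  rw [Measure.map_map hm hm', show ⇑Φ ∘ ⇑Φ.symm = id from funext Φ.apply_symm_apply,
    Measure.map_id]

end Volume

/-! ### Deck transformations are isometries -/

section DeckIsometry

variable {m : ℕ} {H : Type*} [TopologicalSpace H]
  {I : ModelWithCorners ℝ (EuclideanSpace ℝ (Fin m)) H}
  {M₁ M₂ : Type*} [TopologicalSpace M₁] [ChartedSpace H M₁] [TopologicalSpace M₂]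
  [ChartedSpace H M₂] {p : M₂ → M₁}

/-- Near `y`, the homeomorphism `g` is `p` followed by the smooth local inverse of `p` around `g y`.
-/
lemma contMDiff_deck (hp : IsLocalDiffeomorph I I ∞ p) (g : deckTransformationGroup p) :
    ContMDiff I I ∞ g.1 := by
  intro y
  obtain ⟨Φ, hy, hΦ⟩ := hp (g.1 y)
  have hpy : p y ∈ Φ.target := by
    rw [← g.2 y, hΦ hy]
    exact Φ.map_source hy
  refine ContMDiffAt.congr_of_eventuallyEq
    (((Φ.contMDiffOn_invFun _ hpy).contMDiffAt (Φ.open_target.mem_nhds hpy)).comp y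
      (hp.contMDiff y)) ?_
  filter_upwards [g.1.continuous.continuousAt.preimage_mem_nhds (Φ.open_source.mem_nhds hy)]
    with z hz
  exact ((congrArg Φ.symm ((g.2 z).symm.trans (hΦ hz))).trans (Φ.left_inv hz)).symm

/-- Deck transformations are diffeomorphisms. -/
def deckDiffeomorph (hp : IsLocalDiffeomorph I I ∞ p) (g : deckTransformationGroup p) :
    M₂ ≃ₘ^∞⟮I, I⟯ M₂ where
  toEquiv := g.1.toEquiv
  contMDiff_toFun := contMDiff_deck hp g
  contMDiff_invFun := contMDiff_deck hp g⁻¹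

/-- Chain rule for `p ∘ g = p`. The two sides live in the tangent spaces at `p (g y)` and `p y`,
whose base points are only propositionally equal, so they are compared in the model space. -/
lemma mfderiv_deck (hp : IsLocalDiffeomorph I I ∞ p) (g : deckTransformationGroup p) (y : M₂)
    (v : TangentSpace I y) :
    (mfderiv I I p (g.1 y) (mfderiv I I g.1 y v) : EuclideanSpace ℝ (Fin m)) =
      mfderiv I I p y v := by
  have h1 := mfderiv_comp (I'' := I) y ((hp.contMDiff (g.1 y)).mdifferentiableAt (by simp))
    ((contMDiff_deck hp g y).mdifferentiableAt (by simp))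
  have h2 : p ∘ g.1 = p := funext g.2
  have h3 : ∀ {f : M₂ → M₁}, f = p →
      (mfderiv I I f y v : EuclideanSpace ℝ (Fin m)) = mfderiv I I p y v := by
    rintro f rfl
    rfl
  exact (congrArg (fun L ↦ (L v : EuclideanSpace ℝ (Fin m))) h1).symm.trans (h3 h2)

variable [RiemannianBundle (fun x : M₁ ↦ TangentSpace I x)]
  [RiemannianBundle (fun y : M₂ ↦ TangentSpace I y)]

lemma norm_mfderiv_deck (hp : IsRiemannianCovering I p) (g : deckTransformationGroup p) (y : M₂)
    (v : TangentSpace I y) : ‖mfderiv I I g.1 y v‖ = ‖v‖ := by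
  have h1 : ∀ {x x' : M₁} (_ : x = x') {w : TangentSpace I x} {w' : TangentSpace I x'},
      (w : EuclideanSpace ℝ (Fin m)) = w' → ‖w‖ = ‖w'‖ := by
    rintro x _ rfl w w' h
    exact congrArg norm h
  rw [← hp.norm_mfderiv, ← hp.norm_mfderiv y]
  exact h1 (g.2 y) (mfderiv_deck hp.isLocalDiffeomorph g y v)

lemma measurePreserving_deck [IsManifold I ∞ M₂]
    [IsContMDiffRiemannianBundle I ∞ (EuclideanSpace ℝ (Fin m)) (fun x : M₂ ↦ TangentSpace I x)]
    [MeasurableSpace M₂] [BorelSpace M₂] (hp : IsRiemannianCovering I p)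
    (g : deckTransformationGroup p) :
    MeasurePreserving g.1 (riemannianVolume I M₂) (riemannianVolume I M₂) :=
  measurePreserving_riemannianVolume (Φ := deckDiffeomorph hp.isLocalDiffeomorph g)
    (norm_mfderiv_deck hp g) (norm_mfderiv_deck hp g⁻¹)

/-! ### Deck transformations preserve inward normals -/

lemma mem_boundary_deck_iff (hp : IsLocalDiffeomorph I I ∞ p)
    (g : deckTransformationGroup p) {y : M₂} : g.1 y ∈ I.boundary M₂ ↔ y ∈ I.boundary M₂ := by
  have h1 := (deckDiffeomorph hp g).preimage_boundary (by simp)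
  exact Set.ext_iff.1 h1 y

lemma WeaklyInward.mfderiv_deck (hI : range I = univ ∨ ∃ i : Fin m, range I = {x | 0 ≤ x i})
    (hp : IsLocalDiffeomorph I I ∞ p) (g : deckTransformationGroup p) {y : M₂}
    (hy : y ∈ I.boundary M₂) {v : TangentSpace I y} (hv : WeaklyInward I y v) :
    WeaklyInward I (g.1 y) (mfderiv I I g.1 y v) := by
  obtain hI | ⟨i, hI⟩ := hI
  · exact Eventually.of_forall fun t ↦ hI ▸ mem_univ _
  -- A boundary point lies on the hyperplane bounding the half-space. The `i`-th coordinate thus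
  -- vanishes at `y` and `g y`, and inwardness becomes a sign condition on the `i`-th component.
  have hcoord : ∀ z ∈ I.boundary M₂, (extChartAt I z z) i = 0 := fun z hz ↦ by
    have h1 : extChartAt I z z ∈ frontier (range I) := hz
    have h2 : (0 : ℝ) ≤ extChartAt I z z i := by
      have := I.isClosed_range.frontier_subset h1
      rwa [hI] at this
    refine le_antisymm (not_lt.1 fun h3 ↦ h1.2 ?_) h2
    rw [hI]
    refine mem_interior.2 ⟨{x | 0 < x i}, fun x (hx : 0 < x i) ↦ hx.le, ?_, h3⟩
    exact isOpen_lt continuous_const (by fun_prop)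
  have hgy : g.1 y ∈ I.boundary M₂ := (mem_boundary_deck_iff hp g).2 hy
  have hmd : MDifferentiableAt I I g.1 y := (contMDiff_deck hp g y).mdifferentiableAt (by simp)
  have hu : writtenInExtChartAt I I y g.1 (extChartAt I y y) = extChartAt I (g.1 y) (g.1 y) := by
    simp [writtenInExtChartAt]
  set w : EuclideanSpace ℝ (Fin m) := v
  set L : EuclideanSpace ℝ (Fin m) →L[ℝ] EuclideanSpace ℝ (Fin m) := mfderiv I I g.1 y
  have hder : HasFDerivWithinAt (writtenInExtChartAt I I y g.1) L (range I) (extChartAt I y y) :=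
    hmd.hasMFDerivAt.2
  -- `L w` is the limit of difference quotients along the ray in direction `w`, which stays in
  -- `range I` for small `t` because `v` points inward.
  have hlim : Tendsto (fun t : ℝ ↦ t⁻¹ • (writtenInExtChartAt I I y g.1 (extChartAt I y y + t • w) -
      writtenInExtChartAt I I y g.1 (extChartAt I y y))) (𝓝[>] 0) (𝓝 (L w)) := by
    have h1 : Tendsto (fun t : ℝ ↦ t⁻¹ • (t • w)) (𝓝[>] 0) (𝓝 w) := by
      refine tendsto_const_nhds.congr' ?_
      filter_upwards [self_mem_nhdsWithin] with t ht
      rw [smul_smul, inv_mul_cancel₀ (ne_of_gt ht), one_smul]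
    have h2 : Tendsto (fun t : ℝ ↦ t • w) (𝓝[>] 0) (𝓝 0) := by
      have h3 : Continuous fun t : ℝ ↦ t • w := continuous_id.smul continuous_const
      simpa using (h3.tendsto 0).mono_left nhdsWithin_le_nhds
    exact hder.lim h2 hv h1
  have hLw : 0 ≤ L w i := by
    have h1 : Tendsto (fun z : EuclideanSpace ℝ (Fin m) ↦ z i) (𝓝 (L w)) (𝓝 (L w i)) :=
      Continuous.tendsto (by fun_prop) _
    refine ge_of_tendsto (h1.comp hlim) ?_
    filter_upwards [self_mem_nhdsWithin] with t ht
    -- Extended charts end with `I`, so their values lie in `range I` even outside the chart domain.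
    have h2 : writtenInExtChartAt I I y g.1 (extChartAt I y y + t • w) ∈ range I :=
      mem_range_self _
    rw [hI] at h2
    have h3 : (0 : ℝ) ≤ t⁻¹ := inv_nonneg.2 (le_of_lt ht)
    simp only [Function.comp_apply, PiLp.smul_apply, PiLp.sub_apply, hu, hcoord _ hgy, sub_zero,
      smul_eq_mul]
    exact mul_nonneg h3 h2
  have hfin : ∀ᶠ t : ℝ in 𝓝[>] 0, extChartAt I (g.1 y) (g.1 y) + t • L w ∈ range I := by
    filter_upwards [self_mem_nhdsWithin] with t ht
    rw [hI]
    simp only [mem_ofPred_eq, PiLp.add_apply, PiLp.smul_apply, hcoord _ hgy, zero_add, smul_eq_mul]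
    exact mul_nonneg (le_of_lt ht) hLw
  exact hfin

lemma mfderiv_inv_deck (hp : IsLocalDiffeomorph I I ∞ p) (g : deckTransformationGroup p) (y : M₂)
    (v : TangentSpace I y) :
    (mfderiv I I g⁻¹.1 (g.1 y) (mfderiv I I g.1 y v) : EuclideanSpace ℝ (Fin m)) = v := by
  have h1 := mfderiv_comp (I'' := I) y
    ((contMDiff_deck hp g⁻¹ (g.1 y)).mdifferentiableAt (by simp))
    ((contMDiff_deck hp g y).mdifferentiableAt (by simp))
  have h2 : g⁻¹.1 ∘ g.1 = id := funext g.1.symm_apply_apply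
  have h3 : ∀ {f : M₂ → M₂}, f = id →
      (mfderiv I I f y v : EuclideanSpace ℝ (Fin m)) = v := by
    rintro f rfl
    rw [mfderiv_id]
    rfl
  exact (congrArg (fun L ↦ (L v : EuclideanSpace ℝ (Fin m))) h1).symm.trans (h3 h2)

/-- The forward statement for `g⁻¹`. It serves to pull vectors tangent to the boundary back from `g
y` to `y` when orthogonality of the normal is tested. -/
lemma weaklyInward_of_mfderiv_deck (hI : range I = univ ∨ ∃ i : Fin m, range I = {x | 0 ≤ x i})
    (hp : IsLocalDiffeomorph I I ∞ p) (g : deckTransformationGroup p) {y : M₂}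
    (hy : y ∈ I.boundary M₂) {v : TangentSpace I y}
    (hv : WeaklyInward I (g.1 y) (mfderiv I I g.1 y v)) : WeaklyInward I y v := by
  have h1 : ∀ {y' : M₂} (_ : y' = y) {v' : TangentSpace I y'},
      (v' : EuclideanSpace ℝ (Fin m)) = v → WeaklyInward I y' v' → WeaklyInward I y v := by
    rintro _ rfl v' h h'
    obtain rfl : v' = v := h
    exact h'
  exact h1 (g.1.symm_apply_apply y) (mfderiv_inv_deck hp g y v)
    (hv.mfderiv_deck hI hp g⁻¹ ((mem_boundary_deck_iff hp g).2 hy))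

/-- Deck transformations preserve inward pointing unit normals. -/
lemma IsInwardNormal.mfderiv_deck [IsManifold I ∞ M₂]
    (hI : range I = univ ∨ ∃ i : Fin m, range I = {x | 0 ≤ x i})
    (hp : IsRiemannianCovering I p) (g : deckTransformationGroup p) {y : M₂}
    (hy : y ∈ I.boundary M₂) {n : TangentSpace I y} (hn : IsInwardNormal I y n) :
    IsInwardNormal I (g.1 y) (mfderiv I I g.1 y n) where
  norm_eq_one := (norm_mfderiv_deck hp g y n).trans hn.norm_eq_one
  weaklyInward := hn.weaklyInward.mfderiv_deck hI hp.isLocalDiffeomorph g hy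
  inner_eq_zero v hv hv' := by
    have hld := hp.isLocalDiffeomorph
    let e := (deckDiffeomorph hld g).mfderivToContinuousLinearEquiv (by simp) (x := y)
    obtain ⟨w, rfl⟩ : ∃ w : TangentSpace I y, mfderiv I I g.1 y w = v := e.surjective v
    rw [inner_mfderiv_of_norm_mfderiv (norm_mfderiv_deck hp g y)]
    rw [← map_neg] at hv'
    exact hn.inner_eq_zero w (weaklyInward_of_mfderiv_deck hI hld g hy hv)
      (weaklyInward_of_mfderiv_deck hI hld g hy hv')

end DeckIsometry

/-! ### The action of deck transformations on sections -/

section FiberCast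

variable (𝕜 : Type*) [RCLike 𝕜] {M : Type*} {E : M → Type*} [∀ x, AddCommGroup (E x)]
  [∀ x, Module 𝕜 (E x)]

/-- The identification of the fibres over equal points. -/
def fiberCast {x x' : M} (h : x = x') : E x →ₗ[𝕜] E x' :=
  h ▸ LinearMap.id

variable {x x' : M} (h : x = x')

lemma fiberCast_section (s : Π x, E x) : fiberCast 𝕜 h (s x) = s x' := by
  subst h
  rfl

lemma fiberCast_symm_apply (v : E x) : fiberCast 𝕜 h.symm (fiberCast 𝕜 h v) = v := by
  subst h
  rfl

/-- In the total space the cast is invisible. This reduces smoothness of a pulled back section to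
that of the original one. -/
lemma mk_fiberCast (F : Type*) (v : E x) :
    TotalSpace.mk' F x' (fiberCast 𝕜 h v) = TotalSpace.mk' F x v := by
  subst h
  rfl

lemma fiberCast_eq_zero {v : E x} : fiberCast 𝕜 h v = 0 ↔ v = 0 := by
  subst h
  rfl

end FiberCast

section Sections

variable {m : ℕ} {H : Type*} [TopologicalSpace H]
  {I : ModelWithCorners ℝ (EuclideanSpace ℝ (Fin m)) H}
  {M₁ M₂ : Type*} [TopologicalSpace M₁] [ChartedSpace H M₁] [TopologicalSpace M₂]
  [ChartedSpace H M₂]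
  {𝕜 : Type*} [RCLike 𝕜]
  {F : Type*} [NormedAddCommGroup F] [NormedSpace ℝ F] [NormedSpace 𝕜 F] [IsScalarTower ℝ 𝕜 F]
  {E : M₁ → Type*} [∀ x, AddCommGroup (E x)] [∀ x, Module ℝ (E x)] [∀ x, Module 𝕜 (E x)]
  [∀ x, TopologicalSpace (E x)] [TopologicalSpace (TotalSpace F E)] [FiberBundle F E]
  [VectorBundle ℝ F E] [VectorBundle 𝕜 F E] [ContMDiffVectorBundle ∞ F E I]
  {p : C^∞⟮I, M₂; I, M₁⟯}

lemma inner_fiberCast (h : HermitianMetric I 𝕜 F E) {x x' : M₁} (hx : x = x') (v w : E x) :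
    h.inner x' (fiberCast 𝕜 hx v) (fiberCast 𝕜 hx w) = h.inner x v w := by
  subst hx
  rfl

/-- The pullback `g^* η` of a section `η` of `p^* E` under a deck transformation `g`, where the
fibres over `y` and `g y` are identified. -/
def deckPullback (hp : IsLocalDiffeomorph I I ∞ p) (g : deckTransformationGroup p) :
    smoothSections I 𝕜 F (p *ᵖ E) →ₗ[𝕜] smoothSections I 𝕜 F (p *ᵖ E) where
  toFun η := ⟨fun y ↦ fiberCast (E := E) 𝕜 (g.2 y) (η.1 (g.1 y)), fun y ↦ by
    set e := trivializationAt F E (p y) with he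
    have hmem : MemTrivializationAtlas (e.pullback p) := ⟨⟨e, inferInstance, rfl⟩⟩
    refine ((e.pullback p).contMDiffAt_section_iff (IB := I) (n := ∞) (x₀ := y)
      (mem_baseSet_trivializationAt F E (p y))).2 ?_
    have h1 : ContMDiffAt I 𝓘(ℝ, F) ∞ (fun z ↦ (e ⟨p z, η.1 z⟩).2) (g.1 y) :=
      ((e.pullback p).contMDiffAt_section_iff (s := η.1) (IB := I) (n := ∞) (x₀ := g.1 y)
        (by change p (g.1 y) ∈ e.baseSet
            exact (g.2 y).symm ▸ mem_baseSet_trivializationAt F E (p y))).1 (η.2 (g.1 y))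
    -- The base set of the pulled back trivialization is a preimage under `p`, so it contains both
    -- `y` and `g y`, and in this trivialization `g^* η` is the expression of `η` composed with `g`.
    have h2 : (fun z ↦ (e ⟨p z, fiberCast (E := E) 𝕜 (g.2 z) (η.1 (g.1 z))⟩).2) =
        (fun z ↦ (e ⟨p z, η.1 z⟩).2) ∘ g.1 := by
      funext z
      exact congrArg (fun v ↦ (e v).2) (mk_fiberCast 𝕜 (g.2 z) F (η.1 (g.1 z)))
    exact h2 ▸ h1.comp y (contMDiff_deck hp g y)⟩
  map_add' η θ := by
    ext y
    exact map_add (fiberCast (E := E) 𝕜 (g.2 y)) (η.1 (g.1 y)) (θ.1 (g.1 y))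
  map_smul' c η := by
    ext y
    exact map_smul (fiberCast (E := E) 𝕜 (g.2 y)) c (η.1 (g.1 y))

lemma deckPullback_apply (hp : IsLocalDiffeomorph I I ∞ p) (g : deckTransformationGroup p)
    (η : smoothSections I 𝕜 F (p *ᵖ E)) (y : M₂) :
    (deckPullback hp g η).1 y = fiberCast (E := E) 𝕜 (g.2 y) (η.1 (g.1 y)) :=
  rfl

lemma deckPullback_inv_apply (hp : IsLocalDiffeomorph I I ∞ p) (g : deckTransformationGroup p)
    (η : smoothSections I 𝕜 F (p *ᵖ E)) : deckPullback hp g⁻¹ (deckPullback hp g η) = η := by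
  ext y
  -- The point `g⁻¹ y` is replaced by a variable `z` so that the equality `g z = y` can be
  -- eliminated.
  have h1 : ∀ {z : M₂} (hz : p (g.1 z) = p z) (hz' : p z = p y) (_ : g.1 z = y),
      fiberCast (E := E) 𝕜 hz' (fiberCast (E := E) 𝕜 hz (η.1 (g.1 z))) = η.1 y := by
    rintro z hz hz' rfl
    exact fiberCast_symm_apply (E := E) 𝕜 hz _
  exact h1 (g.2 _) (g⁻¹.2 y) (g.1.apply_symm_apply y)

lemma support_deckPullback (hp : IsLocalDiffeomorph I I ∞ p) (g : deckTransformationGroup p)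
    (η : smoothSections I 𝕜 F (p *ᵖ E)) :
    {y | (deckPullback hp g η).1 y ≠ 0} = g.1 ⁻¹' {y | η.1 y ≠ 0} := by
  ext y
  exact not_congr (fiberCast_eq_zero (E := E) 𝕜 (g.2 y))

lemma deckPullback_mem_compactlySupportedSections (hp : IsLocalDiffeomorph I I ∞ p)
    (g : deckTransformationGroup p) {η : smoothSections I 𝕜 F (p *ᵖ E)}
    (hη : η ∈ compactlySupportedSections I 𝕜 F (p *ᵖ E)) :
    deckPullback hp g η ∈ compactlySupportedSections I 𝕜 F (p *ᵖ E) := by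
  change IsCompact (closure {y | (deckPullback hp g η).1 y ≠ 0})
  rw [support_deckPullback, ← g.1.preimage_closure]
  exact g.1.isCompact_preimage.2 hη

/-- The action of a deck transformation on compactly supported sections. -/
def deckPullbackCompact (hp : IsLocalDiffeomorph I I ∞ p) (g : deckTransformationGroup p) :
    compactlySupportedSections I 𝕜 F (p *ᵖ E) ≃ₗ[𝕜] compactlySupportedSections I 𝕜 F (p *ᵖ E) where
  __ := (deckPullback hp g).restrict fun _ hη ↦
    deckPullback_mem_compactlySupportedSections hp g hη
  invFun := (deckPullback hp g⁻¹).restrict fun _ hη ↦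
    deckPullback_mem_compactlySupportedSections hp g⁻¹ hη
  left_inv η := Subtype.ext (deckPullback_inv_apply hp g η.1)
  right_inv η := Subtype.ext (deckPullback_inv_apply hp g⁻¹ η.1)

/-! ### Equivariance of the lifted operator, the lifted connection and the boundary condition. -/

variable [IsManifold I ∞ M₁] [T2Space M₁]

/-- As `p ∘ g = p`, one and the same section of `E` describes `η` near `g y` and `g^* η` near `y`.
All equivariance statements rest on this. -/
lemma descent_deckPullback (hp : IsLocalDiffeomorph I I ∞ p) (g : deckTransformationGroup p)
    {η : smoothSections I 𝕜 F (p *ᵖ E)} {y : M₂} {σ : smoothSections I 𝕜 F E}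
    (hσ : ∀ᶠ z in 𝓝 (g.1 y), σ.1 (p z) = η.1 z) :
    ∀ᶠ z in 𝓝 y, σ.1 (p z) = (deckPullback hp g η).1 z := by
  filter_upwards [g.1.continuous.continuousAt.eventually hσ] with z hz
  rw [deckPullback_apply, ← hz]
  exact (fiberCast_section (E := E) 𝕜 (g.2 z) σ.1).symm

/-- By locality of `D`, any local descent of `η` may replace the chosen `descend`. -/
lemma DifferentialOperator.lift_apply (D : DifferentialOperator I 𝕜 F E)
    (hp : IsLocalDiffeomorph I I ∞ p) {η : smoothSections I 𝕜 F (p *ᵖ E)} {y : M₂}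
    {σ : smoothSections I 𝕜 F E} (hσ : ∀ᶠ z in 𝓝 y, σ.1 (p z) = η.1 z) :
    (D.lift hp η).1 y = (D.toLinearMap σ).1 (p y) := by
  refine D.congr (eventually_eq_of_pullback hp ?_)
  filter_upwards [hσ, descend_spec hp η y] with z h1 h2 using h2.trans h1.symm

/-- The lift of a differential operator is equivariant under deck transformations. -/
lemma DifferentialOperator.lift_deckPullback (D : DifferentialOperator I 𝕜 F E)
    (hp : IsLocalDiffeomorph I I ∞ p) (g : deckTransformationGroup p)
    (η : smoothSections I 𝕜 F (p *ᵖ E)) :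
    D.lift hp (deckPullback hp g η) = deckPullback hp g (D.lift hp η) := by
  ext y
  have hσ := descend_spec hp η (g.1 y)
  rw [D.lift_apply hp (descent_deckPullback hp g hσ), deckPullback_apply, D.lift_apply hp hσ]
  exact (fiberCast_section (E := E) 𝕜 (g.2 y) _).symm

variable [∀ x, IsTopologicalAddGroup (E x)] [∀ x, ContinuousSMul ℝ (E x)]

lemma Connection.lift_apply (nab : Connection I 𝕜 F E) (hp : IsLocalDiffeomorph I I ∞ p)
    {η : smoothSections I 𝕜 F (p *ᵖ E)} {y : M₂} (v : TangentSpace I y)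
    {σ : smoothSections I 𝕜 F E} (hσ : ∀ᶠ z in 𝓝 y, σ.1 (p z) = η.1 z) :
    nab.lift hp y v η = nab.toFun σ.1 (p y) (mfderiv I I p y v) := by
  have h1 : nab.toFun (descend hp η y).1 (p y) = nab.toFun σ.1 (p y) := by
    refine nab.isCovariantDerivativeOnUniv.congr_of_eventuallyEq
      (((descend hp η y).2 _).mdifferentiableAt (by simp)) ((σ.2 _).mdifferentiableAt (by simp))
      univ_mem (eventually_eq_of_pullback hp ?_)
    filter_upwards [hσ, descend_spec hp η y] with z h1 h2 using h2.trans h1.symm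
  exact congrArg (fun L ↦ L (mfderiv I I p y v)) h1

/-- The pullback of a connection is equivariant under deck transformations. -/
lemma Connection.lift_deckPullback (nab : Connection I 𝕜 F E) (hp : IsLocalDiffeomorph I I ∞ p)
    (g : deckTransformationGroup p) (η : smoothSections I 𝕜 F (p *ᵖ E)) (y : M₂)
    (v : TangentSpace I y) :
    nab.lift hp y v (deckPullback hp g η) =
      fiberCast (E := E) 𝕜 (g.2 y) (nab.lift hp (g.1 y) (mfderiv I I g.1 y v) η) := by
  have hσ := descend_spec hp η (g.1 y)
  rw [nab.lift_apply hp _ (descent_deckPullback hp g hσ), nab.lift_apply hp _ hσ]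
  -- Both sides are the derivative of one section of `E` along one vector, with the base point
  -- written as `p (g y)` or as `p y`.
  have h1 : ∀ {x x' : M₁} (hx : x = x') (σ : Π x, E x) {w : TangentSpace I x}
      {w' : TangentSpace I x'}, (w : EuclideanSpace ℝ (Fin m)) = w' →
      nab.toFun σ x' w' = fiberCast (E := E) 𝕜 hx (nab.toFun σ x w) := by
    rintro x _ rfl σ w w' h
    exact congrArg (nab.toFun σ x) h.symm
  exact h1 (g.2 y) _ (mfderiv_deck hp g y v)

variable [RiemannianBundle (fun x : M₁ ↦ TangentSpace I x)]
  [RiemannianBundle (fun y : M₂ ↦ TangentSpace I y)]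

/-- The condition for `g^* η` at `y` with normal `n` is the condition for `η` at `g y` with normal
`dg n`, carried between the fibres. The coefficients match because `a ∘ p` and `b ∘ p` are invariant
under `g`, whatever `a` and `b` are. -/
lemma deckPullback_mem_boundaryCondition [IsManifold I ∞ M₂]
    (hI : range I = univ ∨ ∃ i : Fin m, range I = {x | 0 ≤ x i})
    (hp : IsRiemannianCovering I p) (nab : Connection I 𝕜 F E) (g : deckTransformationGroup p)
    {a b : M₁ → 𝕜} {η : smoothSections I 𝕜 F (p *ᵖ E)}
    (hη : η ∈ boundaryCondition nab hp.isLocalDiffeomorph a b) :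
    deckPullback hp.isLocalDiffeomorph g η ∈ boundaryCondition nab hp.isLocalDiffeomorph a b := by
  intro y hy n hn
  have h1 := hη (g.1 y) ((mem_boundary_deck_iff hp.isLocalDiffeomorph g).2 hy) _
    (hn.mfderiv_deck hI hp g hy)
  rw [congrArg a (g.2 y), congrArg b (g.2 y)] at h1
  have h2 := congrArg (fiberCast (E := E) 𝕜 (g.2 y)) h1
  rw [nab.lift_deckPullback, deckPullback_apply]
  refine Eq.trans ?_ (h2.trans (map_zero _))
  refine Eq.symm ((map_add (fiberCast (E := E) 𝕜 (g.2 y)) _ _).trans ?_)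
  exact congrArg₂ (· + ·) (map_smul (fiberCast (E := E) 𝕜 (g.2 y)) _ _)
    (map_smul (fiberCast (E := E) 𝕜 (g.2 y)) _ _)

end Sections

/-! ### Deck transformations as unitary operators -/

section DeckUnitary

variable {m : ℕ} {H : Type*} [TopologicalSpace H]
  {I : ModelWithCorners ℝ (EuclideanSpace ℝ (Fin m)) H}
  {M₁ M₂ : Type*} [TopologicalSpace M₁] [ChartedSpace H M₁] [TopologicalSpace M₂]
  [ChartedSpace H M₂] [IsManifold I ∞ M₁] [T2Space M₁] [IsManifold I ∞ M₂] [T2Space M₂]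
  [RiemannianBundle (fun x : M₁ ↦ TangentSpace I x)]
  [RiemannianBundle (fun y : M₂ ↦ TangentSpace I y)]
  [IsContMDiffRiemannianBundle I ∞ (EuclideanSpace ℝ (Fin m)) (fun y : M₂ ↦ TangentSpace I y)]
  [MeasurableSpace M₂] [BorelSpace M₂]
  {𝕜 : Type*} [RCLike 𝕜]
  {F : Type*} [NormedAddCommGroup F] [NormedSpace ℝ F] [NormedSpace 𝕜 F] [IsScalarTower ℝ 𝕜 F]
  [FiniteDimensional 𝕜 F]
  {E : M₁ → Type*} [∀ x, AddCommGroup (E x)] [∀ x, Module ℝ (E x)] [∀ x, Module 𝕜 (E x)]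
  [∀ x, TopologicalSpace (E x)] [∀ x, IsTopologicalAddGroup (E x)] [∀ x, ContinuousSMul ℝ (E x)]
  [TopologicalSpace (TotalSpace F E)] [FiberBundle F E]
  [VectorBundle ℝ F E] [VectorBundle 𝕜 F E] [ContMDiffVectorBundle ∞ F E I]
  {p : C^∞⟮I, M₂; I, M₁⟯}

/-- The integrand for the pulled back sections is the original one composed with `g`, and `g`
preserves the volume. -/
lemma inner_deckPullbackCompact (hp : IsRiemannianCovering I p) (h : HermitianMetric I 𝕜 F E)
    (g : deckTransformationGroup p) (s t : PreL2 (h.pullback p)) :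
    inner 𝕜 (E := PreL2 (h.pullback p)) (deckPullbackCompact hp.isLocalDiffeomorph g s)
      (deckPullbackCompact hp.isLocalDiffeomorph g t) = inner 𝕜 s t := by
  have h1 := (measurePreserving_deck hp g).integral_comp' (f := g.1.toMeasurableEquiv)
    fun y ↦ (h.pullback p).inner y (s.1.1 y) (t.1.1 y)
  refine Eq.trans ?_ h1
  refine integral_congr_ae (ae_of_all _ fun y ↦ ?_)
  exact inner_fiberCast h (g.2 y) (s.1.1 (g.1 y)) (t.1.1 (g.1 y))

/-- The unitary operator on `Γ_c(p^* E)` that is given by a deck transformation. -/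
def deckUnitary (hp : IsRiemannianCovering I p) (h : HermitianMetric I 𝕜 F E)
    (g : deckTransformationGroup p) : PreL2 (h.pullback p) ≃ₗᵢ[𝕜] PreL2 (h.pullback p) :=
  LinearEquiv.isometryOfInner
    (deckPullbackCompact hp.isLocalDiffeomorph g : PreL2 (h.pullback p) ≃ₗ[𝕜] PreL2 (h.pullback p))
    (inner_deckPullbackCompact hp h g)

/-- The integrand at `y` involves `s (g y)` and `t y`. It vanishes identically unless `g` moves some
point of the support of `t` into the support of `s`, which proper discontinuity allows for finitely
many `g` only. -/
lemma finite_inner_deckUnitary_ne_zero [ConnectedSpace M₂] (hp : IsRiemannianCovering I p)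
    (h : HermitianMetric I 𝕜 F E) (s t : PreL2 (h.pullback p)) :
    {g | inner 𝕜 (deckUnitary hp h g s) t ≠ 0}.Finite := by
  have := locallyConnectedSpace_of_modelWithCorners I
  have := ChartedSpace.locallyConnectedSpace H M₂
  refine (finite_deck_of_isCompact hp.isCoveringMap t.2 s.2).subset fun g hg ↦ ?_
  by_contra hne
  refine hg ((integral_congr_ae (ae_of_all _ fun y ↦ ?_)).trans (integral_zero M₂ 𝕜))
  change h.inner (p y) (fiberCast (E := E) 𝕜 (g.2 y) (s.1.1 (g.1 y))) (t.1.1 y) = 0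
  by_cases hy : t.1.1 y = 0
  · rw [hy]
    exact map_zero _
  · have hs : s.1.1 (g.1 y) = 0 := by
      by_contra hs
      exact hne ⟨y, subset_closure hy, subset_closure hs⟩
    rw [(fiberCast_eq_zero (E := E) 𝕜 (g.2 y)).2 hs, map_zero]
    rfl

lemma commutesWith_liftedOperator (hI : range I = univ ∨ ∃ i : Fin m, range I = {x | 0 ≤ x i})
    (hp : IsRiemannianCovering I p) (h : HermitianMetric I 𝕜 F E) (nab : Connection I 𝕜 F E)
    (D : DifferentialOperator I 𝕜 F E) (a b : M₁ → 𝕜) (g : deckTransformationGroup p)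
    {W : L2 (h.pullback p) ≃ₗᵢ[𝕜] L2 (h.pullback p)}
    (hW : ∀ s : PreL2 (h.pullback p), W s = (deckUnitary hp h g s : L2 (h.pullback p))) :
    CommutesWith (liftedOperator hp h nab D a b) W :=
  commutesWith_completionOp hW
    (fun _ hs ↦ deckPullback_mem_boundaryCondition hI hp nab g hs)
    fun s ↦ Subtype.ext (D.lift_deckPullback hp.isLocalDiffeomorph g s.1)

end DeckUnitary

end RiemannianCovering

/-- Let `p : M₂ → M₁` be a Riemannian covering of connected manifolds with possibly empty smooth
boundary, and let `D₂` be the lift of a differential operator `D` on a Riemannian or Hermitian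
vector bundle over `M₁`. If `D₂` is symmetric and bounded from below and the deck transformation
group is infinite, then the Friedrichs extension of `D₂` has no eigenvalues of finite multiplicity,
and its spectrum is equal to its essential spectrum. -/
theorem mainTheorem8 {𝕜 : Type*} [RCLike 𝕜] {m : ℕ}
    {H : Type*} [TopologicalSpace H] {I : ModelWithCorners ℝ (EuclideanSpace ℝ (Fin m)) H}
    (hI : range I = univ ∨ ∃ i : Fin m, range I = {x | 0 ≤ x i})
    {M₁ : Type*} [TopologicalSpace M₁] [ChartedSpace H M₁] [IsManifold I ∞ M₁]
    [T2Space M₁] [SecondCountableTopology M₁] [ConnectedSpace M₁]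
    [RiemannianBundle (fun x : M₁ ↦ TangentSpace I x)]
    [IsContMDiffRiemannianBundle I ∞ (EuclideanSpace ℝ (Fin m)) (fun x : M₁ ↦ TangentSpace I x)]
    {M₂ : Type*} [TopologicalSpace M₂] [ChartedSpace H M₂] [IsManifold I ∞ M₂]
    [T2Space M₂] [SecondCountableTopology M₂] [ConnectedSpace M₂]
    [RiemannianBundle (fun y : M₂ ↦ TangentSpace I y)]
    [IsContMDiffRiemannianBundle I ∞ (EuclideanSpace ℝ (Fin m)) (fun y : M₂ ↦ TangentSpace I y)]
    [MeasurableSpace M₂] [BorelSpace M₂]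
    {p : C^∞⟮I, M₂; I, M₁⟯} (hp : IsRiemannianCovering I p)
    {F : Type*} [NormedAddCommGroup F] [NormedSpace ℝ F] [NormedSpace 𝕜 F] [IsScalarTower ℝ 𝕜 F]
    [FiniteDimensional 𝕜 F]
    {E : M₁ → Type*} [∀ x, AddCommGroup (E x)] [∀ x, Module ℝ (E x)] [∀ x, Module 𝕜 (E x)]
    [∀ x, TopologicalSpace (E x)] [∀ x, IsTopologicalAddGroup (E x)]
    [∀ x, ContinuousSMul ℝ (E x)]
    [TopologicalSpace (TotalSpace F E)] [FiberBundle F E] [VectorBundle ℝ F E]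
    [VectorBundle 𝕜 F E] [ContMDiffVectorBundle ∞ F E I]
    (h : HermitianMetric I 𝕜 F E) (nab : Connection I 𝕜 F E)
    (D : DifferentialOperator I 𝕜 F E) (a b : M₁ → 𝕜)
    (hsymm : IsSymmetricOp (liftedOperator hp h nab D a b))
    (hbdd : IsBoundedFromBelow (liftedOperator hp h nab D a b))
    (hdeck : Infinite (deckTransformationGroup p)) :
    (∀ μ : 𝕜, ¬ IsEigenvalueOfFiniteMultiplicity
        (friedrichsExtension (liftedOperator hp h nab D a b) hbdd) μ) ∧
      spectrumOf (friedrichsExtension (liftedOperator hp h nab D a b) hbdd) =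
        essentialSpectrum (friedrichsExtension (liftedOperator hp h nab D a b) hbdd) := by
  have hU : ∀ u v : L2 (h.pullback p), Tendsto
      (fun g ↦ inner 𝕜 (completionIsometry (deckUnitary hp h g) u) v) cofinite (𝓝 0) :=
    tendsto_inner_completionIsometry (finite_inner_deckUnitary_ne_zero hp h)
  have hA : ∀ g, CommutesWith (liftedOperator hp h nab D a b)
      (completionIsometry (deckUnitary hp h g)) := fun g ↦
    commutesWith_liftedOperator hI hp h nab D a b g (completionIsometry_coe _)
  have hA' : ∀ g, CommutesWith (liftedOperator hp h nab D a b)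
      (completionIsometry (deckUnitary hp h g)).symm := fun g ↦
    -- The inverse of `deckUnitary hp h g` is by construction the pullback under `g⁻¹`.
    commutesWith_liftedOperator hI hp h nab D a b g⁻¹ (completionIsometry_symm_coe _)
  have hF := fun g ↦ (hA g).friedrichsExtension hbdd (hA' g)
  have hF' := fun g ↦ (hA' g).friedrichsExtension hbdd (hA g)
  exact ⟨not_isEigenvalueOfFiniteMultiplicity hU hF, spectrumOf_eq_essentialSpectrum hU hF hF'⟩
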